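/- **Automata.** Fix finite sets $A$ (actions) and $AP$ (atomic propositions) and a discount factor $0<\lambda<1$. For a finite set $S$ let $\mathrm{Dist}(S)$ be the set of probability distributions on $S$, and let $C(S)$ be the set of constraints on $S$, a constraint $\varphi$ being identified with its set $Sat(\varphi)\subseteq \mathrm{Dist}(S)$ of solutions. A *probabilistic automaton* (PA) is $P=(S,A,L,AP,V,s_0)$ with $S$ finite, $s_0\in S$, $L:S\times A\times \mathrm{Dist}(S)\to\{\top,\bot\}$, $V:S\to 2^{AP}$. An *abstract probabilistic automaton* (APA) is $N=(S,A,L,AP,V,S_0)$ with $S$ finite, $S_0\subseteq S$, $L:S\times A\times C(S)\to\{\top,?,\bot\}$, $V:S\to 2^{2^{AP}}$. A PA is regarded as an APA with $S_0=\{s_0\}$, labellings $\{V(s)\}$ and, for each transition to $\mu$, a $\top$-transition to the constraint with only solution $\mu$. $N$ is in *SVNF* if $|V(s)|\le 1$ for all $s$. $N$ is *deterministic* if each state has at most one transition (a $\varphi$ with $L(s,a,\varphi)\neq\bot$) per action, if $V(t)\cap V(t')=\emptyset$ for any two different states $t,t'$ that have positive probability in some solutions of the constraint of one and the same transition, and if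 $S_0$ is a singleton. $N$ is *locally consistent* if $V(s)\ne\emptyset$ for all $s$, and $Sat(\varphi)\neq\emptyset$ whenever $L(s,a,\varphi)\ne\bot$. **Refinement.** For $\mu\in \mathrm{Dist}(S)$, $\mu'\in \mathrm{Dist}(S')$, $R\subseteq S\times S'$ and $\delta:S\to(S'\to[0,1])$, write $\mu\Subset_R^\delta\mu'$ if $\delta(s)$ is a distribution whenever $\mu(s)>0$, $\sum_s\mu(s)\delta(s)(s')=\mu'(s')$ for all $s'$, and $\delta(s)(s')>0$ implies $(s,s')\in R$; write $\mu\Subset_R\mu'$ if this holds for some $\delta$, and omit $R$ when $R=S\times S'$. A *refinement relation* between $N_1$ and $N_2$ is an $R\subseteq S_1\times S_2$ such that for all $(s_1,s_2)\in R$: $V_1(s_1)\subseteq V_2(s_2)$; for all $a$ and $\varphi_2$ with $L_2(s_2,a,\varphi_2)=\top$ there is $\varphi_1$ with $L_1(s_1,a,\varphi_1)=\top$ such that every $\mu_1\in Sat(\varphi_1)$ has a $\mu_2\in Sat(\varphi_2)$ with $\mu_1\Subset_R\mu_2$; and for all $a$ and $\varphi_1$ with $L_1(s_1,a,\varphi_1)\ne\bot$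 there is $\varphi_2$ with $L_2(s_2,a,\varphi_2)\neq\bot$ and the same property. $N_1\preceq N_2$ if some refinement relation relates each initial state of $N_1$ to an initial state of $N_2$. $[\![N]\!]$ is the set of all PAs $P$ with $P\preceq N$. **Distance.** For $d:S_1\times S_2\to[0,1]$ let $D(\varphi_1,\varphi_2,d)=\sup_{\mu_1\in Sat(\varphi_1)}\inf_{\mu_2\in Sat(\varphi_2)}\inf_{\delta:\mu_1\Subset^\delta\mu_2}\sum_{s_1,s_2}\mu_1(s_1)\delta(s_1)(s_2)d(s_1,s_2)$. States $s_1,s_2$ are *compatible* if $V_1(s_1)=V_2(s_2)$, each action with a non-$\bot$ transition from $s_1$ has one from $s_2$, and each action with a $\top$-transition from $s_2$ has one from $s_1$. Let $d$ be the least fixed point of the equations $d(s_1,s_2)=1$ for incompatible states and $$d(s_1,s_2)=\max\Big\{\sup_{a,\varphi_1:L_1(s_1,a,\varphi_1)\neq\bot}\ \inf_{\varphi_2:L_2(s_2,a,\varphi_2)\ne\bot}\lambda D(\varphi_1,\varphi_2,d),\ \sup_{a,\varphi_2:L_2(s_2,a,\varphi_2)=\top}\ \inf_{\varphi_1:L_1(s_1,a,\varphi_1)=\top}\lambda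 D(\varphi_1,\varphi_2,d)\Big\}$$ otherwise. For PAs $d(P,P')$ is the distance $d$ of the initial states. For sets $X,Y$ of PAs, the *thorough distance* is $d_t(X,Y)=\sup_{P\in X}\inf_{P'\in Y}d(P,P')$. **The over-approximating difference $N_1\setminus^*N_2$**, for deterministic APAs in SVNF with initial states $s_0^1,s_0^2$. If $V_1(s_0^1)\neq V_2(s_0^2)$, it is $N_1$. Otherwise let $R$ be the maximal refinement relation between $N_1$ and $N_2$. Say that $(s_1,s_2)$ is *in case 3* if $(s_1,s_2)\notin R$ and $V_1(s_1)=V_2(s_2)$. For such a pair define sets of actions as follows, where $\varphi_i$ ranges over the constraint of the $e$-transition of $s_i$: $e\in B_a$ (resp. $B_b$) if $L_1(s_1,e,\varphi_1)=\top$ (resp. $?$) and $s_2$ has no $e$-transition; $e\in B_c$ if $L_1(s_1,e,\varphi_1)\ne\bot$, $L_2(s_2,e,\varphi_2)={?}$ and some $\mu\in Sat(\varphi_1)$ has $\mu\not\Subset_R\mu'$ for all $\mu'\in Sat(\varphi_2)$; $e\in B_d$ if $L_2(s_2,e,\varphi_2)=\top$ and $s_1$ has no $e$-transition; $e\in B_e$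 if $L_2(s_2,e,\varphi_2)=\top$ and $L_1(s_1,e,\varphi_1)={?}$; $e\in B_f$ if $L_1(s_1,e,\varphi_1)=L_2(s_2,e,\varphi_2)=\top$ and some $\mu\in Sat(\varphi_1)$ has $\mu\not\Subset_R\mu'$ for all $\mu'\in Sat(\varphi_2)$. $B(s_1,s_2)$ is the union of these six sets, and $B(s_1,s_2)=\emptyset$ for pairs that are not in case 3 or with $s_2=\bot$. The APA $N_1\setminus^*N_2$ has state set $S=S_1\times(S_2\cup\{\bot\})\times(A\cup\{\epsilon\})$, labels $V(s_1,s_2,e)=V_1(s_1)$, initial states $(s_0^1,s_0^2,f)$ for $f\in B(s_0^1,s_0^2)$, and the following transitions. * For $\varphi\in C(S_1)$, $\varphi^\bot\in C(S)$ is satisfied by the $\mu$ that are concentrated on $S_1\times\{\bot\}\times\{\epsilon\}$ with $(s_1\mapsto\mu(s_1,\bot,\epsilon))\in Sat(\varphi)$. * For $(s_1,s_2,e)$ with $s_2\neq\bot$, $e\ne\epsilon$ and constraints $\varphi_1,\varphi_2$ of the $e$-transitions of $s_1,s_2$, $\varphi^B_{12}\in C(S)$ is satisfied by $\mu$ iff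 (1) whenever $\mu(s_1',s_2',c)>0$, then $s_2'$ is the potential $e$-successor of $s_2$ (a state with positive probability in some solution of the constraint of the $e$-transition of $s_2$) that has $V_2(s_2')=V_1(s_1')$, or $s_2'=\bot$ if there is none, and $c\in B(s_1',s_2')\cup\{\epsilon\}$; (2) the marginal of $\mu$ on $S_1$ is in $Sat(\varphi_1)$; (3) $\mu(s_1',\bot,c)>0$ for some $s_1',c$, or the function $s_2'\mapsto\sum_{s_1',c}\mu(s_1',s_2',c)$ on $S_2$ is not in $Sat(\varphi_2)$, or $\mu(s_1',s_2',c)>0$ for some $s_1'\in S_1$, $s_2'\in S_2$, $c\ne\epsilon$. * Write *copying* for: $L(t,a,\varphi^\bot)=L_1(s_1,a,\varphi)$ for the $a$ and $\varphi$ with $L_1(s_1,a,\varphi)\ne\bot$. At a state $t=(s_1,s_2,e)$ with $s_2=\bot$ or $e=\epsilon$ or $(s_1,s_2)$ not in case 3, all actions are copied. Otherwise: if $e\in B_a\cup B_b$, the actions other than $e$ are copied and $L(t,e,\varphi_1^\bot)=\top$; if $e\in B_d$, all actions are copied; if $e\in B_e$, the actions other than $e$ are copied and $L(t,e,\varphi_{12}^B)={?}$;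 if $e\in B_c\cup B_f$, all actions are copied and in addition $L(t,e,\varphi_{12}^B)=\top$. All other values of $L$ are $\bot$. **Corollary.** Let $N_1$ and $N_2$ be deterministic APAs in SVNF such that $N_1\not\preceq N_2$, and let $N_1$ be locally consistent. Then $$d_t\big([\![N_1\setminus^*N_2]\!],\ [\![N_1]\!]\setminus[\![N_2]\!]\big)=0 .$$ -/

import Mathlib

open scoped ENNReal NNReal

universe u v

/-- A constraint over distributions on `S`, identified with its set of satisfying distributions. -/
abbrev DistConstraint (S : Type u) : Type u := Set (PMF S)

/-- The three modalities: a transition is required, allowed, or forbidden. -/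
inductive Modality : Type
  | must
  | may
  | bot

/-- Probabilistic automata over the actions `A` and the atomic propositions `AP`. -/
structure PA (A : Type u) (AP : Type v) where
  State : Type u
  fintypeState : Fintype State
  /-- `L s a μ` holds iff there is a transition from `s` under `a` to `μ`. -/
  L : State → A → PMF State → Prop
  V : State → Set AP
  init : State

/-- Abstract probabilistic automata over the actions `A` and the atomic propositions `AP`. -/
structure APA (A : Type u) (AP : Type v) where
  State : Type u
  fintypeState : Fintype State
  L : State → A → DistConstraint State → Modality
  V : State → Set (Set AP)
  init : Set State

attribute [instance] PA.fintypeState APA.fintypeState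

noncomputable section

open Classical in
/-- A PA seen as an APA: each transition becomes a required transition to a one-element
constraint, and each state admits exactly its own labelling. -/
def PA.toAPA {A : Type u} {AP : Type v} (P : PA A AP) : APA A AP where
  State := P.State
  fintypeState := P.fintypeState
  L s a φ := if ∃ μ, φ = {μ} ∧ P.L s a μ then .must else .bot
  V s := {P.V s}
  init := {P.init}

/-- `μ` is simulated by `μ'` with respect to the relation `R` and the correspondence
function `δ`. -/
def Simulated {S S' : Type u} [Fintype S] [Fintype S'] (μ : PMF S) (μ' : PMF S')
    (R : S → S' → Prop) (δ : S → S' → ℝ≥0∞) : Prop :=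
  (∀ s s', δ s s' ≤ 1) ∧
  (∀ s, 0 < μ s → ∑ s', δ s s' = 1) ∧
  (∀ s', ∑ s, μ s * δ s s' = μ' s') ∧
  (∀ s s', 0 < δ s s' → R s s')

namespace APA

variable {A : Type u} {AP : Type v}

/-- Single valuation normal form. -/
def IsSVNF (N : APA A AP) : Prop := ∀ s, (N.V s).Subsingleton

/-- Determinism: at most one transition per state and action; two different states reachable
by the same transition have disjoint sets of admissible labellings; one initial state. -/
def IsDeterministic (N : APA A AP) : Prop :=
  (∀ s a φ φ', N.L s a φ ≠ .bot → N.L s a φ' ≠ .bot → φ = φ') ∧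
  (∀ s a φ, N.L s a φ ≠ .bot → ∀ μ ∈ φ, ∀ μ' ∈ φ, ∀ t t', 0 < μ t → 0 < μ' t' → t ≠ t' →
    Disjoint (N.V t) (N.V t')) ∧
  (∃ s₀, N.init = {s₀})

/-- No state is inconsistent: every state admits a labelling, and the constraint of every
transition is satisfiable. -/
def IsLocallyConsistent (N : APA A AP) : Prop :=
  (∀ s, (N.V s).Nonempty) ∧ (∀ s a φ, N.L s a φ ≠ .bot → φ.Nonempty)

/-- `N.succ s a v` is the set of potential `a`-successors of `s` with valuation `v`. -/
def succ (N : APA A AP) (s : N.State) (a : A) (v : Set AP) : Set N.State :=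
  {s' | N.V s' = {v} ∧ ∃ φ, ∃ μ ∈ φ, N.L s a φ ≠ .bot ∧ 0 < μ s'}

/-! ### Refinement -/

def IsRefinement (N₁ N₂ : APA A AP) (R : N₁.State → N₂.State → Prop) : Prop :=
  ∀ s₁ s₂, R s₁ s₂ →
    N₁.V s₁ ⊆ N₂.V s₂ ∧
    (∀ a φ₂, N₂.L s₂ a φ₂ = .must → ∃ φ₁, N₁.L s₁ a φ₁ = .must ∧
      ∀ μ₁ ∈ φ₁, ∃ μ₂ ∈ φ₂, ∃ δ, Simulated μ₁ μ₂ R δ) ∧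
    (∀ a φ₁, N₁.L s₁ a φ₁ ≠ .bot → ∃ φ₂, N₂.L s₂ a φ₂ ≠ .bot ∧
      ∀ μ₁ ∈ φ₁, ∃ μ₂ ∈ φ₂, ∃ δ, Simulated μ₁ μ₂ R δ)

def Refines (N₁ N₂ : APA A AP) : Prop :=
  ∃ R, IsRefinement N₁ N₂ R ∧ ∀ s₁ ∈ N₁.init, ∃ s₂ ∈ N₂.init, R s₁ s₂

/-- The set of implementations of `N`. -/
def impl (N : APA A AP) : Set (PA A AP) := {P | P.toAPA.Refines N}

/-- The maximal refinement relation, i.e. the union of all refinement relations. -/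
def maxRefinement (N₁ N₂ : APA A AP) (s₁ : N₁.State) (s₂ : N₂.State) : Prop :=
  ∃ R, IsRefinement N₁ N₂ R ∧ R s₁ s₂

/-! ### Distances -/

/-- The distance between constraints induced by a distance `d` between states. -/
def constraintDist {S₁ S₂ : Type u} [Fintype S₁] [Fintype S₂]
    (φ₁ : DistConstraint S₁) (φ₂ : DistConstraint S₂) (d : S₁ → S₂ → ℝ≥0∞) : ℝ≥0∞ :=
  ⨆ μ₁ ∈ φ₁, ⨅ μ₂ ∈ φ₂, ⨅ δ, ⨅ _ : Simulated μ₁ μ₂ (fun _ _ => True) δ,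
    ∑ s₁, ∑ s₂, μ₁ s₁ * δ s₁ s₂ * d s₁ s₂

def Compatible (N₁ N₂ : APA A AP) (s₁ : N₁.State) (s₂ : N₂.State) : Prop :=
  N₁.V s₁ = N₂.V s₂ ∧
  (∀ a φ₁, N₁.L s₁ a φ₁ ≠ .bot → ∃ φ₂, N₂.L s₂ a φ₂ ≠ .bot) ∧
  (∀ a φ₂, N₂.L s₂ a φ₂ = .must → ∃ φ₁, N₁.L s₁ a φ₁ = .must)

theorem constraintDist_mono {S₁ S₂ : Type u} [Fintype S₁] [Fintype S₂]
    (φ₁ : DistConstraint S₁) (φ₂ : DistConstraint S₂) {d d' : S₁ → S₂ → ℝ≥0∞} (h : d ≤ d') :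
    constraintDist φ₁ φ₂ d ≤ constraintDist φ₁ φ₂ d' :=
  iSup₂_mono fun _ _ => iInf₂_mono fun _ _ => iInf₂_mono fun _ _ =>
    Finset.sum_le_sum fun s₁ _ => Finset.sum_le_sum fun s₂ _ => mul_le_mul_right (h s₁ s₂) _

open Classical in
/-- The right-hand side of the fixed point equation for the distance between states, with
discount factor `lam`. The truncation at `1` keeps the values in `[0,1]` when a constraint of
`N₂` is unsatisfiable (an infimum over the empty set); otherwise it has no effect on functions
with values in `[0,1]`. -/
def stateDistFun (lam : ℝ≥0) (N₁ N₂ : APA A AP) (d : N₁.State → N₂.State → ℝ≥0∞)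
    (s₁ : N₁.State) (s₂ : N₂.State) : ℝ≥0∞ :=
  if ¬ Compatible N₁ N₂ s₁ s₂ then 1
  else min 1 (max
    (⨆ a, ⨆ φ₁, ⨆ _ : N₁.L s₁ a φ₁ ≠ .bot,
      ⨅ φ₂, ⨅ _ : N₂.L s₂ a φ₂ ≠ .bot, (lam : ℝ≥0∞) * constraintDist φ₁ φ₂ d)
    (⨆ a, ⨆ φ₂, ⨆ _ : N₂.L s₂ a φ₂ = .must,
      ⨅ φ₁, ⨅ _ : N₁.L s₁ a φ₁ = .must, (lam : ℝ≥0∞) * constraintDist φ₁ φ₂ d))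

theorem stateDistFun_mono (lam : ℝ≥0) (N₁ N₂ : APA A AP) {d d' : N₁.State → N₂.State → ℝ≥0∞}
    (h : d ≤ d') (s₁ : N₁.State) (s₂ : N₂.State) :
    stateDistFun lam N₁ N₂ d s₁ s₂ ≤ stateDistFun lam N₁ N₂ d' s₁ s₂ := by
  have hD : ∀ φ₁ φ₂, (lam : ℝ≥0∞) * constraintDist φ₁ φ₂ d ≤ lam * constraintDist φ₁ φ₂ d' :=
    fun φ₁ φ₂ => mul_le_mul_right (constraintDist_mono φ₁ φ₂ h) _
  unfold stateDistFun
  by_cases hc : Compatible N₁ N₂ s₁ s₂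
  · rw [if_neg (not_not.mpr hc), if_neg (not_not.mpr hc)]
    refine min_le_min le_rfl (max_le_max ?_ ?_)
    · exact iSup_mono fun _ => iSup₂_mono fun _ _ => iInf₂_mono fun _ _ => hD _ _
    · exact iSup_mono fun _ => iSup₂_mono fun _ _ => iInf₂_mono fun _ _ => hD _ _
  · rw [if_pos hc, if_pos hc]

/-- `stateDistFun` as a monotone map. -/
def stateDistStep (lam : ℝ≥0) (N₁ N₂ : APA A AP) :
    (N₁.State → N₂.State → ℝ≥0∞) →o (N₁.State → N₂.State → ℝ≥0∞) where
  toFun := stateDistFun lam N₁ N₂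
  monotone' := fun _ _ h s₁ s₂ => stateDistFun_mono lam N₁ N₂ h s₁ s₂

/-- The discounted distance between states: the least fixed point. -/
def stateDist (lam : ℝ≥0) (N₁ N₂ : APA A AP) : N₁.State → N₂.State → ℝ≥0∞ :=
  OrderHom.lfp (stateDistStep lam N₁ N₂)

/-- The discounted (syntactic) distance between automata. -/
def syntacticDist (lam : ℝ≥0) (N₁ N₂ : APA A AP) : ℝ≥0∞ :=
  ⨆ s₁ ∈ N₁.init, ⨅ s₂ ∈ N₂.init, stateDist lam N₁ N₂ s₁ s₂

end APA

/-- The thorough distance between sets of probabilistic automata. -/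
def thoroughDist {A : Type u} {AP : Type v} (lam : ℝ≥0) (X Y : Set (PA A AP)) : ℝ≥0∞ :=
  ⨆ P₁ ∈ X, ⨅ P₂ ∈ Y, APA.syntacticDist lam P₁.toAPA P₂.toAPA

namespace APA

variable {A : Type u} {AP : Type v}

/-! ### The over-approximating difference -/

section Difference

variable (N₁ N₂ : APA A AP)

/-- The pair is in no refinement relation although the valuations agree. -/
def Case3 (s₁ : N₁.State) (s₂ : N₂.State) : Prop :=
  ¬ maxRefinement N₁ N₂ s₁ s₂ ∧ N₁.V s₁ = N₂.V s₂

/-- Some distribution in `φ₁` is simulated by no distribution in `φ₂`. -/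
def SimulationFails (φ₁ : DistConstraint N₁.State) (φ₂ : DistConstraint N₂.State) : Prop :=
  ∃ μ ∈ φ₁, ∀ μ' ∈ φ₂, ¬ ∃ δ, Simulated μ μ' (maxRefinement N₁ N₂) δ

def Ba (s₁ : N₁.State) (s₂ : N₂.State) : Set A :=
  {e | Case3 N₁ N₂ s₁ s₂ ∧ ∃ φ₁, N₁.L s₁ e φ₁ = .must ∧ ∀ φ₂, N₂.L s₂ e φ₂ = .bot}

def Bb (s₁ : N₁.State) (s₂ : N₂.State) : Set A :=
  {e | Case3 N₁ N₂ s₁ s₂ ∧ ∃ φ₁, N₁.L s₁ e φ₁ = .may ∧ ∀ φ₂, N₂.L s₂ e φ₂ = .bot}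

def Bc (s₁ : N₁.State) (s₂ : N₂.State) : Set A :=
  {e | Case3 N₁ N₂ s₁ s₂ ∧ ∃ φ₁, N₁.L s₁ e φ₁ ≠ .bot ∧
    ∃ φ₂, N₂.L s₂ e φ₂ = .may ∧ SimulationFails N₁ N₂ φ₁ φ₂}

def Bd (s₁ : N₁.State) (s₂ : N₂.State) : Set A :=
  {e | Case3 N₁ N₂ s₁ s₂ ∧ ∃ φ₂, N₂.L s₂ e φ₂ = .must ∧ ∀ φ₁, N₁.L s₁ e φ₁ = .bot}

def Be (s₁ : N₁.State) (s₂ : N₂.State) : Set A :=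
  {e | Case3 N₁ N₂ s₁ s₂ ∧ ∃ φ₂, N₂.L s₂ e φ₂ = .must ∧ ∃ φ₁, N₁.L s₁ e φ₁ = .may}

def Bf (s₁ : N₁.State) (s₂ : N₂.State) : Set A :=
  {e | Case3 N₁ N₂ s₁ s₂ ∧ ∃ φ₂, N₂.L s₂ e φ₂ = .must ∧
    ∃ φ₁, N₁.L s₁ e φ₁ = .must ∧ SimulationFails N₁ N₂ φ₁ φ₂}

/-- The breaking actions of a pair of states. -/
def breakSet (s₁ : N₁.State) (s₂ : N₂.State) : Set A :=
  Ba N₁ N₂ s₁ s₂ ∪ Bb N₁ N₂ s₁ s₂ ∪ Bc N₁ N₂ s₁ s₂ ∪ Bd N₁ N₂ s₁ s₂ ∪ Be N₁ N₂ s₁ s₂ ∪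
    Bf N₁ N₂ s₁ s₂

/-- States of the difference: `none` stands for `⊥` in the second component and for `ε` in the
third. -/
abbrev DiffState : Type u := N₁.State × Option N₂.State × Option A

/-- The constraint `φ^⊥`. -/
def botConstraint (φ : DistConstraint N₁.State) : DistConstraint (DiffState N₁ N₂) :=
  {μ | (∀ s₁ x c, (x ≠ none ∨ c ≠ none) → μ (s₁, x, c) = 0) ∧
    ∃ ν ∈ φ, ∀ s₁, ν s₁ = μ (s₁, none, none)}

/-- The potential `e`-successors of `s₂` that have the same valuation as `s₁'`. -/
def matching (s₂ : N₂.State) (e : A) (s₁' : N₁.State) : Set N₂.State :=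
  {u | ∃ v ∈ N₁.V s₁', u ∈ N₂.succ s₂ e v}

/-- The constraint `φ₁₂^B` at the states `(s₁, s₂, e)`. -/
def breakConstraint [Fintype A] (s₂ : N₂.State) (e : A) (φ₁ : DistConstraint N₁.State)
    (φ₂ : DistConstraint N₂.State) : DistConstraint (DiffState N₁ N₂) :=
  {μ |
    (∀ s₁' x c, 0 < μ (s₁', x, c) →
      ((matching N₁ N₂ s₂ e s₁' = ∅ ∧ x = none) ∨
        ∃ s₂' ∈ matching N₁ N₂ s₂ e s₁', x = some s₂') ∧
      (c = none ∨ ∃ s₂' b, x = some s₂' ∧ c = some b ∧ b ∈ breakSet N₁ N₂ s₁' s₂')) ∧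
    (∃ ν ∈ φ₁, ∀ s₁', ν s₁' = ∑ c : Option A, ∑ x : Option N₂.State, μ (s₁', x, c)) ∧
    ((∃ s₁' c, 0 < μ (s₁', none, c)) ∨
      (¬ ∃ ν ∈ φ₂, ∀ s₂', ν s₂' = ∑ c : Option A, ∑ s₁' : N₁.State, μ (s₁', some s₂', c)) ∨
      (∃ s₁' s₂' b, 0 < μ (s₁', some s₂', some b)))}

open Classical in
/-- The transitions of `N₁` at `s₁`, with each constraint `φ` replaced by `φ^⊥`. -/
def copyL (s₁ : N₁.State) (b : A) (ψ : DistConstraint (DiffState N₁ N₂)) : Modality :=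
  if ∃ φ, N₁.L s₁ b φ = .must ∧ ψ = botConstraint N₁ N₂ φ then .must
  else if ∃ φ, N₁.L s₁ b φ = .may ∧ ψ = botConstraint N₁ N₂ φ then .may
  else .bot

/-- `ψ` is the constraint `φ₁₂^B` for transitions `φ₁` of `s₁` and `φ₂` of `s₂` under `e`. -/
def IsBreakConstraint [Fintype A] (s₁ : N₁.State) (s₂ : N₂.State) (e : A)
    (ψ : DistConstraint (DiffState N₁ N₂)) : Prop :=
  ∃ φ₁ φ₂, N₁.L s₁ e φ₁ ≠ .bot ∧ N₂.L s₂ e φ₂ ≠ .bot ∧ ψ = breakConstraint N₁ N₂ s₂ e φ₁ φ₂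

open Classical in
/-- The transition function of the difference. The states `(s₁, s₂, e)` with `(s₁, s₂)` in
case 3 and `e` not a breaking action are never reached; they get no transitions. -/
def diffL [Fintype A] :
    DiffState N₁ N₂ → A → DistConstraint (DiffState N₁ N₂) → Modality
  | (s₁, some s₂, some e), b, ψ =>
    if Case3 N₁ N₂ s₁ s₂ then
      if e ∈ Ba N₁ N₂ s₁ s₂ ∪ Bb N₁ N₂ s₁ s₂ then
        if b = e then
          if ∃ φ₁, N₁.L s₁ e φ₁ ≠ .bot ∧ ψ = botConstraint N₁ N₂ φ₁ then .must else .bot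
        else copyL N₁ N₂ s₁ b ψ
      else if e ∈ Bd N₁ N₂ s₁ s₂ then copyL N₁ N₂ s₁ b ψ
      else if e ∈ Be N₁ N₂ s₁ s₂ then
        if b = e then
          if IsBreakConstraint N₁ N₂ s₁ s₂ e ψ then .may else .bot
        else copyL N₁ N₂ s₁ b ψ
      else if e ∈ Bc N₁ N₂ s₁ s₂ ∪ Bf N₁ N₂ s₁ s₂ then
        if b = e ∧ IsBreakConstraint N₁ N₂ s₁ s₂ e ψ then .must
        else copyL N₁ N₂ s₁ b ψ
      else .bot
    else copyL N₁ N₂ s₁ b ψ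
  | (s₁, _, _), b, ψ => copyL N₁ N₂ s₁ b ψ

open Classical in
/-- The over-approximating difference of two deterministic automata. -/
def overDiff [Fintype A] : APA A AP :=
  if ∃ s₁ ∈ N₁.init, ∃ s₂ ∈ N₂.init, N₁.V s₁ ≠ N₂.V s₂ then N₁
  else
    { State := DiffState N₁ N₂
      fintypeState := inferInstance
      L := diffL N₁ N₂
      V := fun t => N₁.V t.1
      init := {t | ∃ s₁ ∈ N₁.init, ∃ s₂ ∈ N₂.init, ∃ f ∈ breakSet N₁ N₂ s₁ s₂,
        t = (s₁, some s₂, some f)} }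

end Difference

end APA

end

/-!
An implementation `P` of the difference `overDiff N₁ N₂` always implements `N₁`, since the
projection to the first component turns transitions of the difference into transitions of `N₁`. It
may also implement `N₂`: at a state `(s₁, s₂, e)` the breaking constraint allows a behaviour that
conforms to `N₂` for the moment and promises to break later, and this promise may be passed on
forever. The proof shows that for every `k` there is an automaton `Q` that is bisimilar to `P` up to depth `k`
(`Close`), implements `N₁` and does not implement `N₂`. Bisimilarity up to depth `k` bounds the
discounted distance by `lam ^ k` (`Close.stateDist_le`), so the infimum over `Q` is zero.

`Q` is built by induction on `k` (`exists_close_implements_not_implements`). Suppose that `p`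
implements `(s₁, s₂, e)`, where `e` is a breaking action. A fresh root receives the transitions of
`p`; a successor `p'` that implements `t` is replaced by an automaton close to it up to depth
`k - 1`, which exists by induction if `t` carries a breaking action, and is `P` started at `p'`
otherwise. If `e` breaks because only one of `s₁` and `s₂` has an `e`-transition, the root inherits
the break from `p`. Otherwise it lacks an `e`-transition that `s₂` requires, or has one that comes
from the breaking constraint. In the latter case, if the root implemented `s₂`, then by determinism
of `N₂` each successor would have to implement the unique successor of `s₂` with its label, which is
excluded by each of the three alternatives of that constraint
(`not_coupled_of_map_mem_breakConstraint`).

For `k = 0` it suffices that `s₁` has some implementation that does not implement `s₂`. This is the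
contrapositive of `isRefinement_thoroughlyRefines`: for automata in single valuation normal form,
with `N₁` locally consistent and `N₂` deterministic, inclusion of implementations is itself a
refinement relation.

Correspondence functions are replaced throughout by Markov kernels (`Coupled`), and refinements of
`P.toAPA` by the relation `Implements`, the greatest fixed point of `ImplStep`.
-/

/-! ### Couplings of distributions -/

/-- `μ` and `ν` are coupled along `R`: some Markov kernel `δ` carries `μ` to `ν` and moves each
point of the support of `μ` to `R`-related points only. -/
def Coupled {S S' : Type*} (R : S → S' → Prop) (μ : PMF S) (ν : PMF S') : Prop :=
  ∃ δ : S → PMF S', μ.bind δ = ν ∧ ∀ s ∈ μ.support, ∀ s' ∈ (δ s).support, R s s'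

/-- Correspondence functions are Markov kernels, up to their irrelevant values at the states of
probability zero. -/
theorem exists_simulated_iff_coupled {S S' : Type u} [Fintype S] [Fintype S'] {μ : PMF S}
    {ν : PMF S'} {R : S → S' → Prop} : (∃ δ, Simulated μ ν R δ) ↔ Coupled R μ ν := by
  classical
  constructor
  · rintro ⟨δ, -, hsum, hmarg, hR⟩
    obtain ⟨y, -⟩ := ν.support_nonempty
    refine ⟨fun s => if h : 0 < μ s then PMF.ofFintype (δ s) (hsum s h) else PMF.pure y, ?_, ?_⟩
    · ext s'
      rw [PMF.bind_apply, tsum_fintype, ← hmarg s']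
      refine Finset.sum_congr rfl fun s _ => ?_
      by_cases h : 0 < μ s
      · simp [h]
      · simp [nonpos_iff_eq_zero.mp (not_lt.mp h)]
    · intro s hs s' hs'
      have h : 0 < μ s := pos_iff_ne_zero.mpr ((μ.mem_support_iff s).mp hs)
      refine hR s s' (pos_iff_ne_zero.mpr ?_)
      simpa [h] using hs'
  · rintro ⟨δ, rfl, hR⟩
    refine ⟨fun s s' => if μ s = 0 then 0 else δ s s', ?_, ?_, ?_, ?_⟩
    · intro s s'
      dsimp only
      split_ifs
      · exact zero_le_one
      · exact (δ s).coe_le_one s'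
    · intro s hs
      simp only [hs.ne', if_false]
      rw [← tsum_fintype (L := .unconditional _)]
      exact (δ s).tsum_coe
    · intro s'
      rw [PMF.bind_apply, tsum_fintype]
      refine Finset.sum_congr rfl fun s _ => ?_
      by_cases h : μ s = 0 <;> simp [h]
    · intro s s' h
      by_cases h0 : μ s = 0
      · simp [h0] at h
      · simp only [h0, if_false] at h
        exact hR s ((μ.mem_support_iff s).mpr h0) s' (((δ s).mem_support_iff s').mpr h.ne')

namespace Coupled

theorem mono {S S' : Type*} {R R' : S → S' → Prop} {μ : PMF S} {ν : PMF S'}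
    (hc : Coupled R μ ν) (h : ∀ s ∈ μ.support, ∀ s' ∈ ν.support, R s s' → R' s s') :
    Coupled R' μ ν := by
  obtain ⟨δ, rfl, hR⟩ := hc
  refine ⟨δ, rfl, fun s hs s' hs' => h s hs s' ?_ (hR s hs s' hs')⟩
  rw [PMF.mem_support_bind_iff]
  exact ⟨s, hs, hs'⟩

theorem map_self {S S' : Type*} {R : S → S' → Prop} {μ : PMF S} (f : S → S')
    (h : ∀ s ∈ μ.support, R s (f s)) : Coupled R μ (μ.map f) := by
  refine ⟨fun s => PMF.pure (f s), rfl, fun s hs s' hs' => ?_⟩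
  rw [PMF.mem_support_pure_iff] at hs'
  exact hs' ▸ h s hs

theorem refl {S : Type*} {R : S → S → Prop} (h : ∀ s, R s s) (μ : PMF S) : Coupled R μ μ := by
  simpa [PMF.map_id] using map_self (R := R) (μ := μ) id fun s _ => h s

theorem map_right {S S' T : Type*} {R : S → S' → Prop} {R' : S → T → Prop} {μ : PMF S}
    {ν : PMF S'} (f : S' → T) (hc : Coupled R μ ν) (h : ∀ s s', R s s' → R' s (f s')) :
    Coupled R' μ (ν.map f) := by
  obtain ⟨δ, rfl, hR⟩ := hc
  refine ⟨fun s => (δ s).map f, (PMF.map_bind _ _ _).symm, fun s hs t ht => ?_⟩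
  rw [PMF.mem_support_map_iff] at ht
  obtain ⟨s', hs', rfl⟩ := ht
  exact h s s' (hR s hs s' hs')

theorem map_left_iff {S S' T : Type*} {R : T → S' → Prop} {μ : PMF S} {ν : PMF S'} {f : S → T}
    (hf : Function.Injective f) :
    Coupled R (μ.map f) ν ↔ Coupled (fun s s' => R (f s) s') μ ν := by
  classical
  constructor
  · rintro ⟨δ, rfl, hR⟩
    refine ⟨δ ∘ f, (PMF.bind_map _ _ _).symm, fun s hs s' hs' => hR _ ?_ s' hs'⟩
    rw [PMF.mem_support_map_iff]
    exact ⟨s, hs, rfl⟩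
  · rintro ⟨δ, rfl, hR⟩
    obtain ⟨s₀, -⟩ := μ.support_nonempty
    have hinv : ∀ s, Function.extend f δ (fun _ => δ s₀) (f s) = δ s := hf.extend_apply _ _
    refine ⟨Function.extend f δ fun _ => δ s₀, ?_, fun t ht s' hs' => ?_⟩
    · rw [PMF.bind_map]
      congr 1
      exact funext hinv
    · rw [PMF.mem_support_map_iff] at ht
      obtain ⟨s, hs, rfl⟩ := ht
      rw [hinv] at hs'
      exact hR s hs s' hs'

/-- A coupling has a joint distribution, of which its first marginal is a quotient. -/
theorem exists_joint {S S' : Type*} {R : S → S' → Prop} {μ : PMF S} {ν : PMF S'}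
    (hc : Coupled R μ ν) : ∃ ω : PMF (S × S'), ω.map Prod.fst = μ ∧ ω.map Prod.snd = ν ∧
      Coupled (fun s i => s = i.1) μ ω ∧ ∀ i ∈ ω.support, R i.1 i.2 := by
  obtain ⟨δ, rfl, hδ⟩ := hc
  refine ⟨μ.bind fun s => (δ s).map (Prod.mk s), ?_, ?_,
    ⟨fun s => (δ s).map (Prod.mk s), rfl, fun s _ i hi => ?_⟩, fun i hi => ?_⟩
  · rw [PMF.map_bind]
    simp only [PMF.map_comp]
    exact (congrArg μ.bind (funext fun s => PMF.map_const (δ s) s)).trans (PMF.bind_pure μ)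
  · rw [PMF.map_bind]
    simp only [PMF.map_comp]
    exact congrArg μ.bind (funext fun s => PMF.map_id (δ s))
  · obtain ⟨s', -, rfl⟩ := (PMF.mem_support_map_iff _ _ _).mp hi
    rfl
  · obtain ⟨s, hs, hi⟩ := (PMF.mem_support_bind_iff _ _ _).mp hi
    obtain ⟨s', hs', rfl⟩ := (PMF.mem_support_map_iff _ _ _).mp hi
    exact hδ s hs s' hs'

end Coupled

/-! ### Implementations -/

namespace APA

variable {A : Type u} {AP : Type v}

theorem toAPA_L_eq_must_iff {P : PA A AP} {p : P.State} {a : A} {φ : DistConstraint P.State} :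
    P.toAPA.L p a φ = .must ↔ ∃ μ, φ = {μ} ∧ P.L p a μ := by
  simp only [PA.toAPA]
  split_ifs with h <;> simpa using h

theorem toAPA_L_ne_bot_iff {P : PA A AP} {p : P.State} {a : A} {φ : DistConstraint P.State} :
    P.toAPA.L p a φ ≠ .bot ↔ ∃ μ, φ = {μ} ∧ P.L p a μ := by
  simp only [PA.toAPA]
  split_ifs with h <;> simpa using h

/-- The state `p` of `P` satisfies the requirements of the state `s` of `N`, where successor
states are compared through `R`. -/
def ImplStep (P : PA A AP) (N : APA A AP) (R : P.State → N.State → Prop) (p : P.State)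
    (s : N.State) : Prop :=
  P.V p ∈ N.V s ∧
  (∀ a φ, N.L s a φ = .must → ∃ μ, P.L p a μ ∧ ∃ ν ∈ φ, Coupled R μ ν) ∧
  (∀ a μ, P.L p a μ → ∃ φ, N.L s a φ ≠ .bot ∧ ∃ ν ∈ φ, Coupled R μ ν)

theorem isRefinement_toAPA_iff {P : PA A AP} {N : APA A AP} {R : P.State → N.State → Prop} :
    IsRefinement P.toAPA N R ↔ ∀ p s, R p s → ImplStep P N R p s := by
  have hs : ∀ (μ : PMF P.State) (ν : PMF N.State),
      (∃ δ, @Simulated P.toAPA.State N.State _ _ μ ν R δ) ↔ Coupled R μ ν :=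
    fun μ ν => exists_simulated_iff_coupled
  unfold IsRefinement ImplStep
  refine forall_congr' fun p => forall_congr' fun s => imp_congr_right fun _ => ?_
  refine and_congr ?_ (and_congr ?_ ?_)
  · exact Set.singleton_subset_iff
  · refine forall_congr' fun a => forall_congr' fun φ => imp_congr_right fun _ => ?_
    constructor
    · rintro ⟨φ₁, h, h'⟩
      obtain ⟨μ, rfl, hμ⟩ := toAPA_L_eq_must_iff.mp h
      obtain ⟨ν, hν, hc⟩ := h' μ rfl
      exact ⟨μ, hμ, ν, hν, (hs μ ν).mp hc⟩
    · rintro ⟨μ, hμ, ν, hν, hc⟩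
      refine ⟨{μ}, toAPA_L_eq_must_iff.mpr ⟨μ, rfl, hμ⟩, ?_⟩
      rintro _ rfl
      exact ⟨ν, hν, (hs _ ν).mpr hc⟩
  · refine forall_congr' fun a => ?_
    constructor
    · rintro h μ hμ
      obtain ⟨φ, hφ, h'⟩ := h {μ} (toAPA_L_ne_bot_iff.mpr ⟨μ, rfl, hμ⟩)
      obtain ⟨ν, hν, hc⟩ := h' μ rfl
      exact ⟨φ, hφ, ν, hν, (hs μ ν).mp hc⟩
    · rintro h φ₁ hφ₁
      obtain ⟨μ, rfl, hμ⟩ := toAPA_L_ne_bot_iff.mp hφ₁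
      obtain ⟨φ, hφ, ν, hν, hc⟩ := h μ hμ
      refine ⟨φ, hφ, ?_⟩
      rintro _ rfl
      exact ⟨ν, hν, (hs _ ν).mpr hc⟩

theorem ImplStep.mono {P : PA A AP} {N : APA A AP} {R R' : P.State → N.State → Prop}
    (hR : ∀ p s, R p s → R' p s) {p : P.State} {s : N.State} (h : ImplStep P N R p s) :
    ImplStep P N R' p s := by
  have hc : ∀ {μ ν}, Coupled R μ ν → Coupled R' μ ν :=
    fun hc => hc.mono fun s _ s' _ => hR s s'
  refine ⟨h.1, fun a φ hφ => ?_, fun a μ hμ => ?_⟩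
  · obtain ⟨μ, hμ, ν, hν, h⟩ := h.2.1 a φ hφ
    exact ⟨μ, hμ, ν, hν, hc h⟩
  · obtain ⟨φ, hφ, ν, hν, h⟩ := h.2.2 a μ hμ
    exact ⟨φ, hφ, ν, hν, hc h⟩

/-- The state `p` of `P` implements the state `s` of `N`: the relation
`maxRefinement P.toAPA N`, spelled out without the one-element constraints of `P.toAPA`. -/
def Implements (P : PA A AP) (N : APA A AP) (p : P.State) (s : N.State) : Prop :=
  ∃ R : P.State → N.State → Prop, (∀ p s, R p s → ImplStep P N R p s) ∧ R p s

theorem Implements.step {P : PA A AP} {N : APA A AP} {p : P.State} {s : N.State}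
    (h : Implements P N p s) : ImplStep P N (Implements P N) p s := by
  obtain ⟨R, hR, hps⟩ := h
  exact (hR p s hps).mono fun p s hps => ⟨R, hR, hps⟩

theorem implements_iff_step {P : PA A AP} {N : APA A AP} {p : P.State} {s : N.State} :
    Implements P N p s ↔ ImplStep P N (Implements P N) p s :=
  ⟨Implements.step, fun h => ⟨_, fun _ _ h' => h'.mono fun _ _ => Implements.step, h⟩⟩

theorem mem_impl_iff {P : PA A AP} {N : APA A AP} :
    P ∈ N.impl ↔ ∃ s ∈ N.init, Implements P N P.init s := by
  constructor
  · rintro ⟨R, hR, hi⟩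
    obtain ⟨s, hs, h⟩ := hi P.init rfl
    exact ⟨s, hs, R, isRefinement_toAPA_iff.mp hR, h⟩
  · rintro ⟨s, hs, R, hR, h⟩
    refine ⟨R, isRefinement_toAPA_iff.mpr hR, ?_⟩
    rintro _ rfl
    exact ⟨s, hs, h⟩

theorem IsSVNF.V_eq {N : APA A AP} (h : N.IsSVNF) {s : N.State} {v : Set AP} (hv : v ∈ N.V s) :
    N.V s = {v} :=
  (h s).eq_singleton_of_mem hv

/-- An embedding of `Q` into `P` as a subautomaton closed under transitions preserves and
reflects implementation. -/
theorem implements_embedding_iff {P Q : PA A AP} {N : APA A AP} {f : Q.State → P.State}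
    (hf : Function.Injective f) (hV : ∀ q, P.V (f q) = Q.V q)
    (hL : ∀ q a μ, P.L (f q) a μ ↔ ∃ μ', Q.L q a μ' ∧ μ = μ'.map f) {q : Q.State}
    {s : N.State} : Implements P N (f q) s ↔ Implements Q N q s := by
  constructor
  · intro h
    refine ⟨fun q s => Implements P N (f q) s, fun q s h => ?_, h⟩
    obtain ⟨h₁, h₂, h₃⟩ := h.step
    refine ⟨hV q ▸ h₁, fun a φ hφ => ?_, fun a μ hμ => ?_⟩
    · obtain ⟨μ, hμ, ν, hν, hc⟩ := h₂ a φ hφ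
      obtain ⟨μ', hμ', rfl⟩ := (hL q a μ).mp hμ
      exact ⟨μ', hμ', ν, hν, (Coupled.map_left_iff hf).mp hc⟩
    · obtain ⟨φ, hφ, ν, hν, hc⟩ := h₃ a _ ((hL q a _).mpr ⟨μ, hμ, rfl⟩)
      exact ⟨φ, hφ, ν, hν, (Coupled.map_left_iff hf).mp hc⟩
  · intro h
    refine ⟨fun p s => ∃ q, p = f q ∧ Implements Q N q s, ?_, q, rfl, h⟩
    rintro _ s ⟨q, rfl, h⟩
    obtain ⟨h₁, h₂, h₃⟩ := h.step
    have hc : ∀ {μ ν}, Coupled (Implements Q N) μ ν →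
        Coupled (fun p s => ∃ q, p = f q ∧ Implements Q N q s) (μ.map f) ν := fun hc =>
      (Coupled.map_left_iff hf).mpr (hc.mono fun q _ s _ h => ⟨q, rfl, h⟩)
    refine ⟨(hV q).symm ▸ h₁, fun a φ hφ => ?_, fun a μ hμ => ?_⟩
    · obtain ⟨μ, hμ, ν, hν, h⟩ := h₂ a φ hφ
      exact ⟨_, (hL q a _).mpr ⟨μ, hμ, rfl⟩, ν, hν, hc h⟩
    · obtain ⟨μ', hμ', rfl⟩ := (hL q a μ).mp hμ
      obtain ⟨φ, hφ, ν, hν, h⟩ := h₃ a μ' hμ'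
      exact ⟨φ, hφ, ν, hν, hc h⟩

/-! ### Closeness of probabilistic automata -/

/-- Bisimilarity of `p` and `q` up to depth `k`. -/
def Close (P Q : PA A AP) : ℕ → P.State → Q.State → Prop
  | 0, _, _ => True
  | k + 1, p, q => P.V p = Q.V q ∧
    (∀ a μ, P.L p a μ → ∃ ν, Q.L q a ν ∧ Coupled (Close P Q k) μ ν) ∧
    (∀ a ν, Q.L q a ν → ∃ μ, P.L p a μ ∧ Coupled (Close P Q k) μ ν)

theorem Close.refl (P : PA A AP) : ∀ k p, Close P P k p p
  | 0, _ => trivial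
  | k + 1, _ => ⟨rfl, fun _ μ hμ => ⟨μ, hμ, .refl (Close.refl P k) μ⟩,
      fun _ μ hμ => ⟨μ, hμ, .refl (Close.refl P k) μ⟩⟩

theorem Close.embedding {P Q Q' : PA A AP} {f : Q.State → Q'.State}
    (hV : ∀ q, Q'.V (f q) = Q.V q)
    (hL : ∀ q a μ, Q'.L (f q) a μ ↔ ∃ μ', Q.L q a μ' ∧ μ = μ'.map f) :
    ∀ {k p q}, Close P Q k p q → Close P Q' k p (f q)
  | 0, _, _, _ => trivial
  | k + 1, p, q, h => by
    refine ⟨h.1.trans (hV q).symm, fun a μ hμ => ?_, fun a ν hν => ?_⟩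
    · obtain ⟨ν, hν, hc⟩ := h.2.1 a μ hμ
      exact ⟨_, (hL q a _).mpr ⟨ν, hν, rfl⟩, hc.map_right f fun _ _ => Close.embedding hV hL⟩
    · obtain ⟨ν', hν', rfl⟩ := (hL q a ν).mp hν
      obtain ⟨μ, hμ, hc⟩ := h.2.2 a ν' hν'
      exact ⟨μ, hμ, hc.map_right f fun _ _ => Close.embedding hV hL⟩

theorem stateDist_eq (lam : ℝ≥0) (N₁ N₂ : APA A AP) (s₁ : N₁.State) (s₂ : N₂.State) :
    stateDist lam N₁ N₂ s₁ s₂ = stateDistFun lam N₁ N₂ (stateDist lam N₁ N₂) s₁ s₂ :=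
  (congrFun (congrFun (OrderHom.map_lfp (stateDistStep lam N₁ N₂)) s₁) s₂).symm

theorem stateDist_le_one (lam : ℝ≥0) (N₁ N₂ : APA A AP) (s₁ : N₁.State) (s₂ : N₂.State) :
    stateDist lam N₁ N₂ s₁ s₂ ≤ 1 := by
  rw [stateDist_eq, stateDistFun]
  split_ifs with h
  · exact min_le_left _ _
  · exact le_rfl

theorem stateDist_le_of_compatible {lam : ℝ≥0} {N₁ N₂ : APA A AP} {s₁ : N₁.State}
    {s₂ : N₂.State} {c : ℝ≥0∞} (h : Compatible N₁ N₂ s₁ s₂)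
    (h₁ : ∀ a φ₁, N₁.L s₁ a φ₁ ≠ .bot → ∃ φ₂, N₂.L s₂ a φ₂ ≠ .bot ∧
      lam * constraintDist φ₁ φ₂ (stateDist lam N₁ N₂) ≤ c)
    (h₂ : ∀ a φ₂, N₂.L s₂ a φ₂ = .must → ∃ φ₁, N₁.L s₁ a φ₁ = .must ∧
      lam * constraintDist φ₁ φ₂ (stateDist lam N₁ N₂) ≤ c) :
    stateDist lam N₁ N₂ s₁ s₂ ≤ c := by
  rw [stateDist_eq, stateDistFun, if_neg (not_not.mpr h)]
  refine (min_le_right _ _).trans (max_le ?_ ?_)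
  · refine iSup_le fun a => iSup₂_le fun φ₁ hφ₁ => ?_
    obtain ⟨φ₂, hφ₂, hle⟩ := h₁ a φ₁ hφ₁
    exact iInf₂_le_of_le φ₂ hφ₂ hle
  · refine iSup_le fun a => iSup₂_le fun φ₂ hφ₂ => ?_
    obtain ⟨φ₁, hφ₁, hle⟩ := h₂ a φ₂ hφ₂
    exact iInf₂_le_of_le φ₁ hφ₁ hle

theorem constraintDist_singleton_le {S₁ S₂ : Type u} [Fintype S₁] [Fintype S₂] {μ : PMF S₁}
    {ν : PMF S₂} {R : S₁ → S₂ → Prop} {d : S₁ → S₂ → ℝ≥0∞} {c : ℝ≥0∞} (h : Coupled R μ ν)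
    (hd : ∀ s₁ s₂, R s₁ s₂ → d s₁ s₂ ≤ c) : constraintDist {μ} {ν} d ≤ c := by
  obtain ⟨δ, h₁, h₂, h₃, h₄⟩ := exists_simulated_iff_coupled.mpr h
  refine iSup₂_le fun μ' hμ' => ?_
  obtain rfl : μ' = μ := hμ'
  refine iInf₂_le_of_le ν rfl (iInf₂_le_of_le δ ⟨h₁, h₂, h₃, fun _ _ _ => trivial⟩ ?_)
  calc ∑ s₁, ∑ s₂, μ' s₁ * δ s₁ s₂ * d s₁ s₂
      ≤ ∑ s₁, ∑ s₂, μ' s₁ * δ s₁ s₂ * c := by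
        refine Finset.sum_le_sum fun s₁ _ => Finset.sum_le_sum fun s₂ _ => ?_
        rcases eq_or_ne (δ s₁ s₂) 0 with h0 | h0
        · simp [h0]
        · exact mul_le_mul_right (hd s₁ s₂ (h₄ s₁ s₂ (pos_iff_ne_zero.mpr h0))) _
    _ = (∑ s₂, ∑ s₁, μ' s₁ * δ s₁ s₂) * c := by
        rw [Finset.sum_comm, Finset.sum_mul]
        simp only [Finset.sum_mul]
    _ = c := by
        rw [Finset.sum_congr rfl fun s₂ _ => h₃ s₂, ← tsum_fintype (L := .unconditional _),
          ν.tsum_coe, one_mul]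

theorem Close.stateDist_le (lam : ℝ≥0) {P Q : PA A AP} :
    ∀ {k p q}, Close P Q k p q → stateDist lam P.toAPA Q.toAPA p q ≤ (lam : ℝ≥0∞) ^ k
  | 0, _, _, _ => by simpa using stateDist_le_one lam _ _ _ _
  | k + 1, p, q, h => by
    obtain ⟨hV, hPQ, hQP⟩ := h
    have hcomp : Compatible P.toAPA Q.toAPA p q := by
      refine ⟨congrArg (singleton (β := Set (Set AP))) hV, fun a φ hφ => ?_, fun a φ hφ => ?_⟩
      · obtain ⟨μ, rfl, hμ⟩ := toAPA_L_ne_bot_iff.mp hφ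
        obtain ⟨ν, hν, -⟩ := hPQ a μ hμ
        exact ⟨{ν}, toAPA_L_ne_bot_iff.mpr ⟨ν, rfl, hν⟩⟩
      · obtain ⟨ν, rfl, hν⟩ := toAPA_L_eq_must_iff.mp hφ
        obtain ⟨μ, hμ, -⟩ := hQP a ν hν
        exact ⟨{μ}, toAPA_L_eq_must_iff.mpr ⟨μ, rfl, hμ⟩⟩
    have hd : ∀ {μ : PMF P.State} {ν : PMF Q.State}, Coupled (Close P Q k) μ ν →
        (lam : ℝ≥0∞) * @constraintDist P.toAPA.State Q.toAPA.State _ _ {μ} {ν}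
          (stateDist lam P.toAPA Q.toAPA) ≤ (lam : ℝ≥0∞) ^ (k + 1) := fun hc => by
      rw [pow_succ']
      exact mul_le_mul_right
        (constraintDist_singleton_le hc fun _ _ h => Close.stateDist_le lam h) _
    refine stateDist_le_of_compatible hcomp (fun a φ hφ => ?_) fun a φ hφ => ?_
    · obtain ⟨μ, rfl, hμ⟩ := toAPA_L_ne_bot_iff.mp hφ
      obtain ⟨ν, hν, hc⟩ := hPQ a μ hμ
      exact ⟨{ν}, toAPA_L_ne_bot_iff.mpr ⟨ν, rfl, hν⟩, hd hc⟩
    · obtain ⟨ν, rfl, hν⟩ := toAPA_L_eq_must_iff.mp hφ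
      obtain ⟨μ, hμ, hc⟩ := hQP a ν hν
      exact ⟨{μ}, toAPA_L_eq_must_iff.mpr ⟨μ, rfl, hμ⟩, hd hc⟩

theorem thoroughDist_eq_zero_of_close {lam : ℝ≥0} (hlam : lam < 1) {X Y : Set (PA A AP)}
    (h : ∀ P ∈ X, ∀ k, ∃ Q ∈ Y, Close P Q k P.init Q.init) : thoroughDist lam X Y = 0 := by
  refine le_antisymm (iSup₂_le fun P hP => ?_) zero_le
  refine ge_of_tendsto' (ENNReal.tendsto_pow_atTop_nhds_zero_of_lt_one
    (r := lam) (by exact_mod_cast hlam)) fun k => ?_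
  obtain ⟨Q, hQ, hc⟩ := h P hP k
  refine iInf₂_le_of_le Q hQ (iSup₂_le ?_)
  rintro _ rfl
  exact iInf₂_le_of_le Q.init rfl (hc.stateDist_le lam)

/-! ### Adding a root to a family of automata -/

/-- The disjoint union of the automata `Q i` with a fresh initial state `none`, labelled `v`.
A distribution `ω` on indices with `T a ω` gives an `a`-transition from the root that enters
`Q i` at its initial state with probability `ω i`. -/
def rootPA {I : Type u} [Fintype I] (v : Set AP) (T : A → PMF I → Prop) (Q : I → PA A AP) :
    PA A AP where
  State := Option (Σ i, (Q i).State)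
  fintypeState := inferInstance
  L
    | none, a, μ => ∃ ω, T a ω ∧ μ = ω.map fun i => some ⟨i, (Q i).init⟩
    | some ⟨i, q⟩, a, μ => ∃ μ', (Q i).L q a μ' ∧ μ = μ'.map fun q => some ⟨i, q⟩
  V
    | none => v
    | some ⟨i, q⟩ => (Q i).V q
  init := none

section Root

variable {I : Type u} [Fintype I] {v : Set AP} {T : A → PMF I → Prop} {Q : I → PA A AP}

theorem rootPA_implements_some_iff {N : APA A AP} {i : I} {q : (Q i).State} {s : N.State} :
    Implements (rootPA v T Q) N (some ⟨i, q⟩) s ↔ Implements (Q i) N q s :=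
  implements_embedding_iff (P := rootPA v T Q) (Q := Q i) (f := fun q => some ⟨i, q⟩)
    (fun _ _ h => eq_of_heq (Sigma.mk.inj_iff.mp (Option.some.inj h)).2) (fun _ => rfl)
    fun _ _ _ => Iff.rfl

theorem Close.rootPA_some {P : PA A AP} {k : ℕ} {i : I} {p : P.State} {q : (Q i).State}
    (h : Close P (Q i) k p q) : Close P (rootPA v T Q) k p (some ⟨i, q⟩) :=
  Close.embedding (Q' := rootPA v T Q) (f := fun q => some ⟨i, q⟩) (fun _ => rfl)
    (fun _ _ _ => Iff.rfl) h

theorem rootPA_coupled_iff {N : APA A AP} {ω : PMF I} {ν : PMF N.State} :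
    Coupled (Implements (rootPA v T Q) N) (ω.map fun i => some ⟨i, (Q i).init⟩) ν ↔
      Coupled (fun i s => Implements (Q i) N (Q i).init s) ω ν := by
  have hinj : Function.Injective fun i => (some ⟨i, (Q i).init⟩ : Option (Σ i, (Q i).State)) :=
    fun i j h => (Sigma.mk.inj_iff.mp (Option.some.inj h)).1
  refine (Coupled.map_left_iff hinj).trans ?_
  simp only [rootPA_implements_some_iff]

theorem rootPA_implements_init_iff {N : APA A AP} {s : N.State} :
    Implements (rootPA v T Q) N (rootPA v T Q).init s ↔ v ∈ N.V s ∧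
      (∀ a φ, N.L s a φ = .must →
        ∃ ω, T a ω ∧ ∃ ν ∈ φ, Coupled (fun i s => Implements (Q i) N (Q i).init s) ω ν) ∧
      (∀ a ω, T a ω → ∃ φ, N.L s a φ ≠ .bot ∧
        ∃ ν ∈ φ, Coupled (fun i s => Implements (Q i) N (Q i).init s) ω ν) := by
  rw [implements_iff_step]
  refine and_congr Iff.rfl (and_congr ?_ ?_)
  · refine forall_congr' fun a => forall_congr' fun φ => imp_congr_right fun _ => ?_
    constructor
    · rintro ⟨_, ⟨ω, hω, rfl⟩, ν, hν, hc⟩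
      exact ⟨ω, hω, ν, hν, rootPA_coupled_iff.mp hc⟩
    · rintro ⟨ω, hω, ν, hν, hc⟩
      exact ⟨_, ⟨ω, hω, rfl⟩, ν, hν, rootPA_coupled_iff.mpr hc⟩
  · refine forall_congr' fun a => ?_
    constructor
    · intro h ω hω
      obtain ⟨φ, hφ, ν, hν, hc⟩ := h _ ⟨ω, hω, rfl⟩
      exact ⟨φ, hφ, ν, hν, rootPA_coupled_iff.mp hc⟩
    · rintro h _ ⟨ω, hω, rfl⟩
      obtain ⟨φ, hφ, ν, hν, hc⟩ := h ω hω
      exact ⟨φ, hφ, ν, hν, rootPA_coupled_iff.mpr hc⟩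

theorem Close.rootPA_init {P : PA A AP} {k : ℕ} {p : P.State} (hV : P.V p = v)
    (h₁ : ∀ a μ, P.L p a μ →
      ∃ ω, T a ω ∧ Coupled (fun p i => Close P (Q i) k p (Q i).init) μ ω)
    (h₂ : ∀ a ω, T a ω →
      ∃ μ, P.L p a μ ∧ Coupled (fun p i => Close P (Q i) k p (Q i).init) μ ω) :
    Close P (rootPA v T Q) (k + 1) p (rootPA v T Q).init := by
  have hc : ∀ {μ ω}, Coupled (fun p i => Close P (Q i) k p (Q i).init) μ ω →
      Coupled (Close P (rootPA v T Q) k) μ (ω.map fun i => some ⟨i, (Q i).init⟩) :=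
    fun hc => hc.map_right _ fun _ _ h => h.rootPA_some
  refine ⟨hV, fun a μ hμ => ?_, ?_⟩
  · obtain ⟨ω, hω, h⟩ := h₁ a μ hμ
    exact ⟨_, ⟨ω, hω, rfl⟩, hc h⟩
  · rintro a _ ⟨ω, hω, rfl⟩
    obtain ⟨μ, hμ, h⟩ := h₂ a ω hω
    exact ⟨μ, hμ, hc h⟩

end Root

/-- `P` started at `p`. -/
def _root_.PA.startAt (P : PA A AP) (p : P.State) : PA A AP := { P with init := p }

theorem Close.startAt (P : PA A AP) (k : ℕ) (p : P.State) :
    Close P (P.startAt p) k p (P.startAt p).init :=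
  Close.embedding (Q := P) (Q' := P.startAt p) (f := id) (fun _ => rfl)
    (fun _ _ μ => ⟨fun h => ⟨μ, h, (PMF.map_id μ).symm⟩, by
      rintro ⟨μ', h, rfl⟩
      have h' : P.L _ _ (μ'.map id) := (PMF.map_id μ').symm ▸ h
      exact h'⟩) (Close.refl P k p)

/-! ### Thorough refinement implies refinement -/

/-- Every automaton that implements `s₁` also implements `s₂`. -/
def ThoroughlyRefines (N₁ N₂ : APA A AP) (s₁ : N₁.State) (s₂ : N₂.State) : Prop :=
  ∀ Q : PA A AP, Implements Q N₁ Q.init s₁ → Implements Q N₂ Q.init s₂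

/-- The implementation of `N` with all transitions that `N` allows. -/
def largestImpl (N : APA A AP) (s : N.State) : PA A AP where
  State := N.State
  fintypeState := N.fintypeState
  L s a μ := ∃ φ, N.L s a φ ≠ .bot ∧ μ ∈ φ
  V s := ⋃₀ N.V s
  init := s

theorem IsSVNF.sUnion_mem {N : APA A AP} (hsv : N.IsSVNF) (hcons : N.IsLocallyConsistent)
    (s : N.State) : ⋃₀ N.V s ∈ N.V s := by
  obtain ⟨v, hv⟩ := hcons.1 s
  simp [hsv.V_eq hv]

theorem implements_largestImpl {N : APA A AP} (hsv : N.IsSVNF) (hcons : N.IsLocallyConsistent)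
    (s : N.State) : Implements (N.largestImpl s) N (N.largestImpl s).init s := by
  refine ⟨fun s' s => s' = s, ?_, rfl⟩
  rintro s' _ rfl
  refine ⟨hsv.sUnion_mem hcons s', fun a φ hφ => ?_, fun a μ ⟨φ, hφ, hμ⟩ => ?_⟩
  · have hφ' : N.L s' a φ ≠ .bot := by simp [hφ]
    obtain ⟨μ, hμ⟩ := hcons.2 s' a φ hφ'
    exact ⟨μ, ⟨φ, hφ', hμ⟩, μ, hμ, .refl (fun _ => rfl) μ⟩
  · exact ⟨φ, hφ, μ, hμ, .refl (fun _ => rfl) μ⟩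

/-- A root with transitions chosen from those allowed at `s`, including the required ones, over
implementations of the states of `N`. -/
theorem implements_rootPA {N : APA A AP} {s : N.State} {v : Set AP}
    {T : A → PMF N.State → Prop} {Q : N.State → PA A AP} (hv : v ∈ N.V s)
    (hQ : ∀ t, Implements (Q t) N (Q t).init t)
    (hmust : ∀ a φ, N.L s a φ = .must → ∃ ω ∈ φ, T a ω)
    (hmay : ∀ a ω, T a ω → ∃ φ, N.L s a φ ≠ .bot ∧ ω ∈ φ) :
    Implements (rootPA v T Q) N (rootPA v T Q).init s := by
  refine rootPA_implements_init_iff.mpr ⟨hv, fun a φ hφ => ?_, fun a ω hω => ?_⟩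
  · obtain ⟨ω, hω, h⟩ := hmust a φ hφ
    exact ⟨ω, h, ω, hω, .refl hQ ω⟩
  · obtain ⟨φ, hφ, h⟩ := hmay a ω hω
    exact ⟨φ, hφ, ω, h, .refl hQ ω⟩

theorem IsDeterministic.matching_unique {N₁ N₂ : APA A AP} (hdet : N₂.IsDeterministic)
    (hsv : N₁.IsSVNF) {s₂ : N₂.State} {e : A} {s₁ : N₁.State} {u u' : N₂.State}
    (hu : u ∈ matching N₁ N₂ s₂ e s₁) (hu' : u' ∈ matching N₁ N₂ s₂ e s₁) : u = u' := by
  obtain ⟨v, hv, hVu, φ, μ, hμ, hφ, hpos⟩ := hu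
  obtain ⟨v', hv', hVu', φ', μ', hμ', hφ', hpos'⟩ := hu'
  obtain rfl := hsv s₁ hv hv'
  obtain rfl := hdet.1 _ _ _ _ hφ hφ'
  by_contra hne
  have := hdet.2.1 _ _ _ hφ μ hμ μ' hμ' u u' hpos hpos' hne
  rw [hVu, hVu'] at this
  simp at this

/-- A state that implements both `s₁` and a state `s₂'` reachable from `s₂` by an `e`-transition
witnesses that `s₂'` matches `s₁`. -/
theorem Implements.mem_matching {N₁ N₂ : APA A AP} (hsv₂ : N₂.IsSVNF) {Q : PA A AP} {q : Q.State}
    {s₁ : N₁.State} {s₂ s₂' : N₂.State} {e : A} {φ : DistConstraint N₂.State}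
    {ν : PMF N₂.State} (h₁ : Implements Q N₁ q s₁) (h₂ : Implements Q N₂ q s₂')
    (hφ : N₂.L s₂ e φ ≠ .bot) (hν : ν ∈ φ) (hs : s₂' ∈ ν.support) :
    s₂' ∈ matching N₁ N₂ s₂ e s₁ :=
  ⟨Q.V q, h₁.step.1, hsv₂.V_eq h₂.step.1, φ, ν, hν, hφ,
    pos_iff_ne_zero.mpr ((ν.mem_support_iff s₂').mp hs)⟩

section Thorough

variable {N₁ N₂ : APA A AP} (hdet₂ : N₂.IsDeterministic) (hsv₁ : N₁.IsSVNF) (hsv₂ : N₂.IsSVNF)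
  (hcons₁ : N₁.IsLocallyConsistent)

include hdet₂ hsv₁ hsv₂ hcons₁

/-- The implementation tested here allows everything, but below each `s₁'` it takes, if there is
one, an implementation of `s₁'` that fails to implement the matching successor of `s₂`. -/
theorem ThoroughlyRefines.exists_coupled {s₁ : N₁.State} {s₂ : N₂.State}
    (h : ThoroughlyRefines N₁ N₂ s₁ s₂) {a : A} {φ₁ : DistConstraint N₁.State}
    (hφ₁ : N₁.L s₁ a φ₁ ≠ .bot) {μ : PMF N₁.State} (hμ : μ ∈ φ₁) :
    ∃ φ₂, N₂.L s₂ a φ₂ ≠ .bot ∧ ∃ ν ∈ φ₂, Coupled (ThoroughlyRefines N₁ N₂) μ ν := by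
  have hQ : ∀ t, ∃ Q : PA A AP, Implements Q N₁ Q.init t ∧
      ∀ t₂ ∈ matching N₁ N₂ s₂ a t, Implements Q N₂ Q.init t₂ → ThoroughlyRefines N₁ N₂ t t₂ := by
    intro t
    by_cases hbad : ∃ t₂ ∈ matching N₁ N₂ s₂ a t, ¬ ThoroughlyRefines N₁ N₂ t t₂
    · obtain ⟨t₂, ht₂, hnot⟩ := hbad
      simp only [ThoroughlyRefines, not_forall] at hnot
      obtain ⟨Q, hQ₁, hQ₂⟩ := hnot
      refine ⟨Q, hQ₁, fun t₂' ht₂' himp => absurd himp ?_⟩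
      rwa [hdet₂.matching_unique hsv₁ ht₂' ht₂]
    · push Not at hbad
      exact ⟨_, implements_largestImpl hsv₁ hcons₁ t, fun t₂ ht₂ _ => hbad t₂ ht₂⟩
  choose Q hQ₁ hQ₂ using hQ
  have himp := implements_rootPA (T := fun b ω => ∃ φ, N₁.L s₁ b φ ≠ .bot ∧ ω ∈ φ)
    (hsv₁.sUnion_mem hcons₁ s₁) hQ₁ (fun b φ hφ => ?_) fun _ _ h => h
  · obtain ⟨φ₂, hφ₂, ν, hν, hc⟩ :=
      (rootPA_implements_init_iff.mp (h _ himp)).2.2 a μ ⟨φ₁, hφ₁, hμ⟩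
    refine ⟨φ₂, hφ₂, ν, hν, hc.mono fun t _ t₂ ht₂ ht => hQ₂ t t₂ ?_ ht⟩
    exact (hQ₁ t).mem_matching hsv₂ ht hφ₂ hν ht₂
  · have hφ' : N₁.L s₁ b φ ≠ .bot := by simp [hφ]
    obtain ⟨ω, hω⟩ := hcons₁.2 s₁ b φ hφ'
    exact ⟨ω, hω, φ, hφ', hω⟩

theorem isRefinement_thoroughlyRefines : IsRefinement N₁ N₂ (ThoroughlyRefines N₁ N₂) := by
  intro s₁ s₂ h
  refine ⟨fun v hv => ?_, fun a φ₂ hφ₂ => ?_, fun a φ₁ hφ₁ => ?_⟩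
  · have h₁ := implements_largestImpl hsv₁ hcons₁ s₁
    have h₂ := (h _ h₁).step.1
    rwa [hsv₁ s₁ h₁.step.1 hv] at h₂
  · -- An implementation with the required transitions only shows that `φ₂` has a counterpart.
    have himp := implements_rootPA (T := fun b ω => ∃ φ, N₁.L s₁ b φ = .must ∧ ω ∈ φ)
      (hsv₁.sUnion_mem hcons₁ s₁) (implements_largestImpl hsv₁ hcons₁) (fun b φ hφ => ?_)
      fun b ω ⟨φ, hφ, hω⟩ => ⟨φ, by simp [hφ], hω⟩
    · obtain ⟨-, ⟨φ₁, hφ₁, -⟩, -⟩ := (rootPA_implements_init_iff.mp (h _ himp)).2.1 a φ₂ hφ₂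
      refine ⟨φ₁, hφ₁, fun μ hμ => ?_⟩
      obtain ⟨φ, hφ, ν, hν, hc⟩ :=
        h.exists_coupled hdet₂ hsv₁ hsv₂ hcons₁ (by simp [hφ₁] : N₁.L s₁ a φ₁ ≠ .bot) hμ
      obtain rfl := hdet₂.1 _ _ _ _ hφ (by simp [hφ₂] : N₂.L s₂ a φ₂ ≠ .bot)
      exact ⟨ν, hν, exists_simulated_iff_coupled.mpr hc⟩
    · obtain ⟨ω, hω⟩ := hcons₁.2 s₁ b φ (by simp [hφ])
      exact ⟨ω, hω, φ, hφ, hω⟩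
  · obtain ⟨μ₀, hμ₀⟩ := hcons₁.2 s₁ a φ₁ hφ₁
    obtain ⟨φ₂, hφ₂, -⟩ := h.exists_coupled hdet₂ hsv₁ hsv₂ hcons₁ hφ₁ hμ₀
    refine ⟨φ₂, hφ₂, fun μ hμ => ?_⟩
    obtain ⟨φ, hφ, ν, hν, hc⟩ := h.exists_coupled hdet₂ hsv₁ hsv₂ hcons₁ hφ₁ hμ
    obtain rfl := hdet₂.1 _ _ _ _ hφ hφ₂
    exact ⟨ν, hν, exists_simulated_iff_coupled.mpr hc⟩

theorem exists_implements_not_implements {s₁ : N₁.State} {s₂ : N₂.State}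
    (h : ¬ maxRefinement N₁ N₂ s₁ s₂) :
    ∃ Q : PA A AP, Implements Q N₁ Q.init s₁ ∧ ¬ Implements Q N₂ Q.init s₂ := by
  by_contra! hall
  exact h ⟨_, isRefinement_thoroughlyRefines hdet₂ hsv₁ hsv₂ hcons₁, hall⟩

end Thorough

/-! ### The transitions of the difference -/

section Difference

variable (N₁ N₂ : APA A AP)

/-- The automaton that `overDiff` builds when the initial labels agree. -/
noncomputable def diffAPA [Fintype A] : APA A AP where
  State := DiffState N₁ N₂
  fintypeState := inferInstance
  L := diffL N₁ N₂
  V := fun t => N₁.V t.1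
  init := {t | ∃ s₁ ∈ N₁.init, ∃ s₂ ∈ N₂.init, ∃ f ∈ breakSet N₁ N₂ s₁ s₂,
    t = (s₁, some s₂, some f)}

variable {N₁ N₂}

/-- The third component of `t` is `ε` or a breaking action of the first two. -/
def Proper (t : DiffState N₁ N₂) : Prop :=
  ∀ c, t.2.2 = some c → ∃ s₂, t.2.1 = some s₂ ∧ c ∈ breakSet N₁ N₂ t.1 s₂

/-- All solutions of `ψ` project to solutions of `φ` and are supported on proper states. -/
def LiesOver (ψ : DistConstraint (DiffState N₁ N₂)) (φ : DistConstraint N₁.State) : Prop :=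
  ∀ μ ∈ ψ, μ.map Prod.fst ∈ φ ∧ ∀ t ∈ μ.support, Proper t

theorem map_apply_eq_sum {S S' : Type*} [Fintype S] [DecidableEq S'] (μ : PMF S) (f : S → S')
    (y : S') : μ.map f y = ∑ x, if y = f x then μ x else 0 := by
  rw [PMF.map_apply, tsum_fintype]
  exact Finset.sum_congr rfl fun x _ => by split_ifs <;> rfl

theorem liesOver_botConstraint (φ : DistConstraint N₁.State) :
    LiesOver (botConstraint N₁ N₂ φ) φ := by
  classical
  rintro μ ⟨hzero, ν, hν, heq⟩
  have hsupp : ∀ t ∈ μ.support, t.2 = (none, none) := by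
    rintro ⟨s, x, c⟩ ht
    by_contra hne
    refine (μ.mem_support_iff _).mp ht (hzero s x c ?_)
    by_contra! h
    exact hne (Prod.ext h.1 h.2)
  constructor
  · convert hν
    ext s
    rw [PMF.map_apply, heq, tsum_eq_single (s, none, none)]
    · simp
    · intro t hne
      split_ifs with h
      · by_contra h0
        exact hne (Prod.ext h.symm (hsupp t ((μ.mem_support_iff t).mpr h0)))
      · rfl
  · intro t ht c hc
    simp [hsupp t ht] at hc

theorem liesOver_breakConstraint [Fintype A] (s₂ : N₂.State) (e : A)
    (φ₁ : DistConstraint N₁.State) (φ₂ : DistConstraint N₂.State) :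
    LiesOver (breakConstraint N₁ N₂ s₂ e φ₁ φ₂) φ₁ := by
  classical
  rintro μ ⟨hsupp, ⟨ν, hν, heq⟩, -⟩
  constructor
  · convert hν
    ext s
    rw [map_apply_eq_sum, heq, Fintype.sum_prod_type, Finset.sum_eq_single s]
    · simp only [if_true]
      rw [Fintype.sum_prod_type, Finset.sum_comm]
    · intro s' _ hne
      simp [hne.symm]
    · simp
  · rintro ⟨s, x, c⟩ ht b rfl
    obtain h | ⟨s₂', b', hx, hb, hmem⟩ :=
      (hsupp s x (some b) (pos_iff_ne_zero.mpr ((μ.mem_support_iff _).mp ht))).2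
    · cases h
    · cases hb
      exact ⟨s₂', hx, hmem⟩

theorem copyL_eq_must {s₁ : N₁.State} {a : A} {φ : DistConstraint N₁.State}
    (h : N₁.L s₁ a φ = .must) : copyL N₁ N₂ s₁ a (botConstraint N₁ N₂ φ) = .must :=
  if_pos ⟨φ, h, rfl⟩

theorem exists_of_copyL_ne_bot {s₁ : N₁.State} {a : A} {ψ : DistConstraint (DiffState N₁ N₂)}
    (h : copyL N₁ N₂ s₁ a ψ ≠ .bot) : ∃ φ, N₁.L s₁ a φ ≠ .bot ∧ LiesOver ψ φ := by
  unfold copyL at h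
  split_ifs at h with h₁ h₂
  · obtain ⟨φ, hφ, rfl⟩ := h₁
    exact ⟨φ, by simp [hφ], liesOver_botConstraint φ⟩
  · obtain ⟨φ, hφ, rfl⟩ := h₂
    exact ⟨φ, by simp [hφ], liesOver_botConstraint φ⟩
  · exact absurd rfl h

theorem IsBreakConstraint.exists_liesOver [Fintype A] {s₁ : N₁.State} {s₂ : N₂.State} {e : A}
    {ψ : DistConstraint (DiffState N₁ N₂)} (h : IsBreakConstraint N₁ N₂ s₁ s₂ e ψ) :
    ∃ φ, N₁.L s₁ e φ ≠ .bot ∧ LiesOver ψ φ := by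
  obtain ⟨φ₁, φ₂, hφ₁, -, rfl⟩ := h
  exact ⟨φ₁, hφ₁, liesOver_breakConstraint s₂ e φ₁ φ₂⟩

/-- Every transition of the difference comes from a transition of `N₁`. -/
theorem exists_of_diffL_ne_bot [Fintype A] {t : DiffState N₁ N₂} {a : A}
    {ψ : DistConstraint (DiffState N₁ N₂)} (h : diffL N₁ N₂ t a ψ ≠ .bot) :
    ∃ φ, N₁.L t.1 a φ ≠ .bot ∧ LiesOver ψ φ := by
  obtain ⟨s₁, _ | s₂, _ | e⟩ := t
  iterate 3 exact exists_of_copyL_ne_bot h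
  simp only [diffL] at h
  split_ifs at h
  all_goals first
    | exact absurd rfl h
    | exact exists_of_copyL_ne_bot h
    | skip
  · obtain ⟨φ, hφ, rfl⟩ := ‹∃ φ, _›
    obtain rfl := ‹a = e›
    exact ⟨φ, hφ, liesOver_botConstraint φ⟩
  · obtain rfl := ‹a = e›
    exact ‹IsBreakConstraint _ _ _ _ _ _›.exists_liesOver
  · obtain ⟨rfl, hbr⟩ := ‹a = e ∧ _›
    exact hbr.exists_liesOver

theorem case3_of_mem_breakSet {s₁ : N₁.State} {s₂ : N₂.State} {e : A}
    (h : e ∈ breakSet N₁ N₂ s₁ s₂) : Case3 N₁ N₂ s₁ s₂ := by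
  rcases h with ((((h | h) | h) | h) | h) | h <;> exact h.1

/-- Every required transition of `N₁` stays required in the difference. -/
theorem exists_diffL_eq_must [Fintype A] (hdet₁ : N₁.IsDeterministic) {t : DiffState N₁ N₂}
    (ht : Proper t) {a : A} {φ : DistConstraint N₁.State} (h : N₁.L t.1 a φ = .must) :
    ∃ ψ, diffL N₁ N₂ t a ψ = .must ∧ LiesOver ψ φ := by
  refine ⟨botConstraint N₁ N₂ φ, ?_, liesOver_botConstraint φ⟩
  have hcopy := copyL_eq_must (N₂ := N₂) h
  have hne : N₁.L t.1 a φ ≠ .bot := by simp [h]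
  obtain ⟨s₁, _ | s₂, _ | e⟩ := t
  iterate 3 exact hcopy
  obtain ⟨_, hs, he⟩ := ht e rfl
  cases hs
  simp only [diffL, if_pos (case3_of_mem_breakSet he)]
  split_ifs with _ hae hbot _ hBe hae hbr hunion hbr
  · rfl
  · exact absurd ⟨φ, hae ▸ hne, rfl⟩ hbot
  · exact hcopy
  · exact hcopy
  iterate 2
    -- A required transition under a breaking action of kind `Be` is impossible.
    obtain ⟨-, -, -, φ₁, hφ₁⟩ := hBe
    obtain rfl := hdet₁.1 _ _ _ _ hne (hae ▸ (by simp [hφ₁]) : N₁.L s₁ a φ₁ ≠ .bot)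
    subst hae
    rw [h] at hφ₁
    cases hφ₁
  · exact hcopy
  · rfl
  · exact hcopy
  · exfalso
    rcases he with ((((he | he) | he) | he) | he) | he <;> simp_all

end Difference

/-! ### Postponing the break -/

section Breaking

variable [Fintype A] {N₁ N₂ : APA A AP}

theorem implements_fst_of_implements_diffAPA (hdet₁ : N₁.IsDeterministic) {P : PA A AP}
    {p : P.State} {t : DiffState N₁ N₂} (h : Implements P (diffAPA N₁ N₂) p t) (ht : Proper t) :
    Implements P N₁ p t.1 := by
  refine ⟨fun p s => ∃ t : DiffState N₁ N₂,
    Implements P (diffAPA N₁ N₂) p t ∧ Proper t ∧ t.1 = s, ?_, t, h, ht, rfl⟩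
  rintro p _ ⟨t, h, ht, rfl⟩
  obtain ⟨hV, hmust, hmay⟩ := h.step
  have hproj : ∀ {ψ : DistConstraint (DiffState N₁ N₂)} {φ : DistConstraint N₁.State}
      {μ : PMF P.State} {ν : PMF (DiffState N₁ N₂)}, LiesOver ψ φ → ν ∈ ψ →
      Coupled (Implements P (diffAPA N₁ N₂)) μ ν → ∃ ν' ∈ φ, Coupled (fun p s =>
        ∃ t : DiffState N₁ N₂, Implements P (diffAPA N₁ N₂) p t ∧ Proper t ∧ t.1 = s) μ ν' := by
    intro ψ φ μ ν hlies hν hc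
    obtain ⟨hφ, hproper⟩ := hlies ν hν
    have hc' : Coupled (fun p (t : DiffState N₁ N₂) =>
        Implements P (diffAPA N₁ N₂) p t ∧ Proper t) μ ν :=
      hc.mono fun _ _ t ht h => ⟨h, hproper t ht⟩
    exact ⟨_, hφ, hc'.map_right Prod.fst fun p t h => ⟨t, h.1, h.2, rfl⟩⟩
  refine ⟨hV, fun a φ hφ => ?_, fun a μ hμ => ?_⟩
  · obtain ⟨ψ, hψ, hlies⟩ := exists_diffL_eq_must hdet₁ ht hφ
    obtain ⟨μ, hμ, ν, hν, hc⟩ := hmust a ψ hψ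
    exact ⟨μ, hμ, hproj hlies hν hc⟩
  · obtain ⟨ψ, hψ, ν, hν, hc⟩ := hmay a μ hμ
    obtain ⟨φ, hφ, hlies⟩ := exists_of_diffL_ne_bot hψ
    exact ⟨φ, hφ, hproj hlies hν hc⟩

/-- By determinism, a coupling with a solution `ν` of `φ₂` has to send each index `i` to the
matching state named in `t i`; this contradicts each of the three ways in which a solution of the
breaking constraint may deviate from `φ₂`. -/
theorem not_coupled_of_map_mem_breakConstraint (hdet₂ : N₂.IsDeterministic) (hsv₁ : N₁.IsSVNF)
    (hsv₂ : N₂.IsSVNF) {I : Type*} {Q : I → PA A AP} {ω : PMF I} {t : I → DiffState N₁ N₂}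
    {s₂ : N₂.State} {e : A} {φ₁ : DistConstraint N₁.State} {φ₂ : DistConstraint N₂.State}
    (hω : ω.map t ∈ breakConstraint N₁ N₂ s₂ e φ₁ φ₂) (hφ₂ : N₂.L s₂ e φ₂ ≠ .bot)
    (hQ₁ : ∀ i ∈ ω.support, Implements (Q i) N₁ (Q i).init (t i).1)
    (hQ₂ : ∀ i ∈ ω.support, ∀ s₂' b, (t i).2 = (some s₂', some b) →
      ¬ Implements (Q i) N₂ (Q i).init s₂')
    {ν : PMF N₂.State} (hν : ν ∈ φ₂) :
    ¬ Coupled (fun i s => Implements (Q i) N₂ (Q i).init s) ω ν := by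
  classical
  intro hc
  obtain ⟨hsupp, -, hbreak⟩ := hω
  obtain ⟨η, rfl, hR⟩ := hc
  have hmem : ∀ {t₀}, 0 < ω.map t t₀ → ∃ i ∈ ω.support, t i = t₀ := fun {t₀} h =>
    (PMF.mem_support_map_iff _ _ _).mp (((ω.map t).mem_support_iff t₀).mpr h.ne')
  have hkey : ∀ i ∈ ω.support, ∀ s ∈ (η i).support, (t i).2.1 = some s := by
    intro i hi s hs
    have hmatch : s ∈ matching N₁ N₂ s₂ e (t i).1 :=
      (hQ₁ i hi).mem_matching hsv₂ (hR i hi s hs) hφ₂ hν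
        ((PMF.mem_support_bind_iff _ _ _).mpr ⟨i, hi, hs⟩)
    have hpos : 0 < ω.map t ((t i).1, (t i).2.1, (t i).2.2) := pos_iff_ne_zero.mpr
      (((ω.map t).mem_support_iff _).mp ((PMF.mem_support_map_iff _ _ _).mpr ⟨i, hi, rfl⟩))
    obtain ⟨hempty, -⟩ | ⟨s', hs', heq⟩ := (hsupp _ _ _ hpos).1
    · rw [hempty] at hmatch
      exact hmatch.elim
    · rw [heq, hdet₂.matching_unique hsv₁ hs' hmatch]
  rcases hbreak with ⟨s₁', c, hpos⟩ | hmarg | ⟨s₁', s₂', b, hpos⟩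
  · obtain ⟨i, hi, hti⟩ := hmem hpos
    obtain ⟨s, hs⟩ := (η i).support_nonempty
    have := hkey i hi s hs
    simp [hti] at this
  · refine hmarg ⟨_, hν, fun s => ?_⟩
    have hsum : (ω.map t).map (fun t₀ => t₀.2.1) (some s) =
        ∑ c : Option A, ∑ s₁' : N₁.State, ω.map t (s₁', some s, c) := by
      rw [map_apply_eq_sum]
      simp only [Fintype.sum_prod_type]
      rw [Finset.sum_comm (s := (Finset.univ : Finset (Option A)))]
      refine Finset.sum_congr rfl fun s₁' _ => ?_
      rw [Finset.sum_eq_single (some s)]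
      · simp
      · intro x _ hne
        simp [hne.symm]
      · simp
    rw [← hsum, PMF.map_comp, PMF.map_apply, PMF.bind_apply]
    refine tsum_congr fun i => ?_
    by_cases h0 : ω i = 0
    · simp [h0]
    have hi := (ω.mem_support_iff i).mpr h0
    simp only [Function.comp_apply]
    split_ifs with h
    · -- The kernel at `i` is supported on `{s}`, so it is the point mass at `s`.
      have hsub : ∀ s' ∈ (η i).support, s' = s := fun s' hs' =>
        Option.some.inj ((hkey i hi s' hs').symm.trans h.symm)
      have hone : η i s = 1 := (PMF.apply_eq_one_iff _ _).mpr
        (((η i).support_nonempty.subset_singleton_iff).mp hsub)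
      rw [hone, mul_one]
    · have hzero : η i s = 0 := by
        by_contra hne
        exact h (hkey i hi s (((η i).mem_support_iff s).mpr hne)).symm
      rw [hzero, mul_zero]
  · obtain ⟨i, hi, hti⟩ := hmem hpos
    obtain ⟨s, hs⟩ := (η i).support_nonempty
    obtain rfl : s₂' = s := by
      have := hkey i hi s hs
      rw [hti] at this
      exact Option.some.inj this
    exact hQ₂ i hi s₂' b (by rw [hti]) (hR i hi s₂' hs)

/-- What the difference demands at a breaking action `e`, and why it separates from `s₂`. -/
theorem diffL_cases_of_mem_breakSet {s₁ : N₁.State} {s₂ : N₂.State} {e : A}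
    (he : e ∈ breakSet N₁ N₂ s₁ s₂) :
    ((∃ ψ, diffL N₁ N₂ (s₁, some s₂, some e) e ψ = .must) ∧ ∀ φ₂, N₂.L s₂ e φ₂ = .bot) ∨
    ((∃ φ₂, N₂.L s₂ e φ₂ = .must) ∧
      ∀ ψ, diffL N₁ N₂ (s₁, some s₂, some e) e ψ ≠ .bot → IsBreakConstraint N₁ N₂ s₁ s₂ e ψ) ∨
    (∃ ψ, diffL N₁ N₂ (s₁, some s₂, some e) e ψ = .must ∧
      IsBreakConstraint N₁ N₂ s₁ s₂ e ψ) := by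
  have hcase := case3_of_mem_breakSet he
  by_cases hab : e ∈ Ba N₁ N₂ s₁ s₂ ∪ Bb N₁ N₂ s₁ s₂
  · left
    obtain ⟨φ₁, hφ₁, hbot⟩ : ∃ φ₁, N₁.L s₁ e φ₁ ≠ .bot ∧ ∀ φ₂, N₂.L s₂ e φ₂ = .bot := by
      obtain ⟨-, φ₁, h, hbot⟩ | ⟨-, φ₁, h, hbot⟩ := hab <;> exact ⟨φ₁, by simp [h], hbot⟩
    refine ⟨⟨botConstraint N₁ N₂ φ₁, ?_⟩, hbot⟩
    simp only [diffL]
    rw [if_pos hcase, if_pos hab, if_pos trivial, if_pos ⟨φ₁, hφ₁, rfl⟩]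
  by_cases hd : e ∈ Bd N₁ N₂ s₁ s₂
  · obtain ⟨-, φ₂, hφ₂, hbot⟩ := hd
    refine Or.inr (Or.inl ⟨⟨φ₂, hφ₂⟩, fun ψ hψ => ?_⟩)
    obtain ⟨φ, hφ, -⟩ := exists_of_diffL_ne_bot hψ
    exact absurd (hbot φ) hφ
  by_cases hBe : e ∈ Be N₁ N₂ s₁ s₂
  · have hmust := hBe.2
    obtain ⟨φ₂, hφ₂, -⟩ := hmust
    refine Or.inr (Or.inl ⟨⟨φ₂, hφ₂⟩, fun ψ hψ => ?_⟩)
    simp only [diffL] at hψ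
    rw [if_pos hcase, if_neg hab, if_neg hd, if_pos hBe, if_pos trivial] at hψ
    by_contra hne
    exact hψ (if_neg hne)
  · have hcf : e ∈ Bc N₁ N₂ s₁ s₂ ∪ Bf N₁ N₂ s₁ s₂ := by
      rcases he with ((((h | h) | h) | h) | h) | h
      exacts [absurd (Or.inl h) hab, absurd (Or.inr h) hab, .inl h, absurd h hd, absurd h hBe,
        .inr h]
    obtain ⟨φ₁, φ₂, hφ₁, hφ₂⟩ : ∃ φ₁ φ₂, N₁.L s₁ e φ₁ ≠ .bot ∧ N₂.L s₂ e φ₂ ≠ .bot := by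
      obtain ⟨-, φ₁, h₁, φ₂, h₂, -⟩ | ⟨-, φ₂, h₂, φ₁, h₁, -⟩ := hcf
      · exact ⟨φ₁, φ₂, h₁, by simp [h₂]⟩
      · exact ⟨φ₁, φ₂, by simp [h₁], by simp [h₂]⟩
    have hbr : IsBreakConstraint N₁ N₂ s₁ s₂ e (breakConstraint N₁ N₂ s₂ e φ₁ φ₂) :=
      ⟨φ₁, φ₂, hφ₁, hφ₂, rfl⟩
    refine Or.inr (Or.inr ⟨_, ?_, hbr⟩)
    simp only [diffL]
    rw [if_pos hcase, if_neg hab, if_neg hd, if_neg hBe, if_pos hcf, if_pos ⟨rfl, hbr⟩]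

/-- Induction on `k`. The transitions of `p` are copied to a fresh root, whose successors are
replaced by automata for `k - 1`; at `k = 0` the break is forced by any implementation of `s₁`
that does not implement `s₂`. -/
theorem exists_close_implements_not_implements (hdet₁ : N₁.IsDeterministic)
    (hdet₂ : N₂.IsDeterministic) (hsv₁ : N₁.IsSVNF) (hsv₂ : N₂.IsSVNF)
    (hcons₁ : N₁.IsLocallyConsistent) (P : PA A AP) (k : ℕ) :
    ∀ {p : P.State} {s₁ : N₁.State} {s₂ : N₂.State} {e : A}, e ∈ breakSet N₁ N₂ s₁ s₂ →
      Implements P (diffAPA N₁ N₂) p (s₁, some s₂, some e) →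
      ∃ Q : PA A AP, Close P Q k p Q.init ∧ Implements Q N₁ Q.init s₁ ∧
        ¬ Implements Q N₂ Q.init s₂ := by
  induction k with
  | zero =>
    intro p s₁ s₂ e he _
    obtain ⟨Q, h₁, h₂⟩ := exists_implements_not_implements hdet₂ hsv₁ hsv₂ hcons₁
      (case3_of_mem_breakSet he).1
    exact ⟨Q, trivial, h₁, h₂⟩
  | succ k ih =>
    intro p s₁ s₂ e he himp
    have hQ : ∀ i : P.State × DiffState N₁ N₂, ∃ Q : PA A AP,
        Implements P (diffAPA N₁ N₂) i.1 i.2 → Proper i.2 → Close P Q k i.1 Q.init ∧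
          Implements Q N₁ Q.init i.2.1 ∧
          ∀ s₂' b, i.2.2 = (some s₂', some b) → ¬ Implements Q N₂ Q.init s₂' := by
      rintro ⟨p', t⟩
      by_cases hi : Implements P (diffAPA N₁ N₂) p' t ∧ Proper t
      swap
      · exact ⟨P, fun h h' => absurd ⟨h, h'⟩ hi⟩
      obtain ⟨hi, hproper⟩ := hi
      have hfst := implements_fst_of_implements_diffAPA hdet₁ hi hproper
      obtain ⟨s₁', x, _ | b⟩ := t
      · refine ⟨P.startAt p', fun _ _ => ⟨Close.startAt P k p', hfst, ?_⟩⟩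
        simp
      · obtain ⟨s₂', hx, hb⟩ := hproper b rfl
        obtain rfl : x = some s₂' := hx
        obtain ⟨Q, h₁, h₂, h₃⟩ := ih hb hi
        refine ⟨Q, fun _ _ => ⟨h₁, h₂, fun s b' hsb => ?_⟩⟩
        obtain rfl : s₂' = s := by simpa using congrArg Prod.fst hsb
        exact h₃
    choose Q hQ using hQ
    -- The root keeps the transitions of `p`, refined by the couplings with the difference.
    let T : A → PMF (P.State × DiffState N₁ N₂) → Prop := fun a ω =>
      P.L p a (ω.map Prod.fst) ∧
      Coupled (fun p i => p = i.1) (ω.map Prod.fst) ω ∧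
      (∃ ψ, diffL N₁ N₂ (s₁, some s₂, some e) a ψ ≠ .bot ∧ ω.map Prod.snd ∈ ψ) ∧
      ∀ i ∈ ω.support, Implements P (diffAPA N₁ N₂) i.1 i.2
    have hT : ∀ {a ψ μ ν}, P.L p a μ → diffL N₁ N₂ (s₁, some s₂, some e) a ψ ≠ .bot → ν ∈ ψ →
        Coupled (Implements P (diffAPA N₁ N₂)) μ ν →
        ∃ ω, T a ω ∧ ω.map Prod.fst = μ ∧ ω.map Prod.snd = ν := by
      intro a ψ μ ν hμ hψ hν hc
      obtain ⟨ω, rfl, rfl, hfst, hi⟩ := hc.exists_joint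
      exact ⟨ω, ⟨hμ, hfst, ⟨ψ, hψ, hν⟩, hi⟩, rfl, rfl⟩
    have hTQ : ∀ {a ω}, T a ω → ∀ i ∈ ω.support, Close P (Q i) k i.1 (Q i).init ∧
        Implements (Q i) N₁ (Q i).init i.2.1 ∧
        ∀ s₂' b, i.2.2 = (some s₂', some b) → ¬ Implements (Q i) N₂ (Q i).init s₂' := by
      rintro a ω ⟨-, -, ⟨ψ, hψ, hω⟩, hi⟩ i his
      obtain ⟨φ, -, hlies⟩ := exists_of_diffL_ne_bot hψ
      refine hQ i (hi i his) ((hlies _ hω).2 _ ?_)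
      exact (PMF.mem_support_map_iff _ _ _).mpr ⟨i, his, rfl⟩
    have hcl : ∀ {a ω}, T a ω →
        Coupled (fun p i => Close P (Q i) k p (Q i).init) (ω.map Prod.fst) ω := by
      intro a ω hω
      refine hω.2.1.mono ?_
      rintro _ - i hi rfl
      exact (hTQ hω i hi).1
    have hproj : ∀ {a ω ψ φ}, T a ω → ω.map Prod.snd ∈ ψ → LiesOver ψ φ →
        ∃ ν ∈ φ, Coupled (fun i s => Implements (Q i) N₁ (Q i).init s) ω ν := by
      intro a ω ψ φ hω hψ hlies
      refine ⟨_, (hlies _ hψ).1, ?_⟩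
      rw [PMF.map_comp]
      exact .map_self _ fun i hi => (hTQ hω i hi).2.1
    have hproper : Proper (N₁ := N₁) (N₂ := N₂) (s₁, some s₂, some e) := by
      rintro _ ⟨⟩
      exact ⟨s₂, rfl, he⟩
    obtain ⟨hV, hmust, hmay⟩ := himp.step
    refine ⟨rootPA (P.V p) T Q, Close.rootPA_init rfl (fun a μ hμ => ?_)
      fun a ω hω => ⟨_, hω.1, hcl hω⟩,
      rootPA_implements_init_iff.mpr ⟨hV, fun a φ hφ => ?_, fun a ω hω => ?_⟩, fun hbad => ?_⟩
    · obtain ⟨ψ, hψ, ν, hν, hc⟩ := hmay a μ hμ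
      obtain ⟨ω, hω, rfl, -⟩ := hT hμ hψ hν hc
      exact ⟨ω, hω, hcl hω⟩
    · obtain ⟨ψ, hψ, hlies⟩ := exists_diffL_eq_must hdet₁ hproper hφ
      obtain ⟨μ, hμ, ν, hν, hc⟩ := hmust a ψ hψ
      obtain ⟨ω, hω, -, rfl⟩ := hT hμ (by simp [hψ]) hν hc
      exact ⟨ω, hω, hproj hω hν hlies⟩
    · obtain ⟨ψ, hψ, hωψ⟩ := hω.2.2.1
      obtain ⟨φ, hφ, hlies⟩ := exists_of_diffL_ne_bot hψ
      exact ⟨φ, hφ, hproj hω hωψ hlies⟩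
    · obtain ⟨-, hmust₂, hmay₂⟩ := rootPA_implements_init_iff.mp hbad
      have hno : ∀ {ω ψ}, T e ω → ω.map Prod.snd ∈ ψ → IsBreakConstraint N₁ N₂ s₁ s₂ e ψ →
          False := by
        rintro ω _ hω hωψ ⟨φ₁, φ₂, -, hφ₂, rfl⟩
        obtain ⟨φ, hφ, ν, hν, hc⟩ := hmay₂ e ω hω
        obtain rfl := hdet₂.1 _ _ _ _ hφ hφ₂
        exact not_coupled_of_map_mem_breakConstraint hdet₂ hsv₁ hsv₂ hωψ hφ₂
          (fun i hi => (hTQ hω i hi).2.1) (fun i hi => (hTQ hω i hi).2.2) hν hc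
      obtain ⟨⟨ψ, hψ⟩, hbot⟩ | ⟨⟨φ₂, hφ₂⟩, hψ⟩ | ⟨ψ, hψ, hbr⟩ := diffL_cases_of_mem_breakSet he
      · obtain ⟨μ, hμ, ν, hν, hc⟩ := hmust e ψ hψ
        obtain ⟨ω, hω, -⟩ := hT hμ (by simp [hψ]) hν hc
        obtain ⟨φ₂, hφ₂, -⟩ := hmay₂ e ω hω
        exact hφ₂ (hbot φ₂)
      · obtain ⟨ω, hω, -⟩ := hmust₂ e φ₂ hφ₂
        obtain ⟨ψ, hne, hωψ⟩ := hω.2.2.1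
        exact hno hω hωψ (hψ ψ hne)
      · obtain ⟨μ, hμ, ν, hν, hc⟩ := hmust e ψ hψ
        obtain ⟨ω, hω, -, rfl⟩ := hT hμ (by simp [hψ]) hν hc
        exact hno hω hν hbr

end Breaking

end APA

theorem mainTheorem5 {A : Type u} {AP : Type v} [Fintype A] [Finite AP]
    (lam : ℝ≥0) (hlam₀ : 0 < lam) (hlam₁ : lam < 1)
    (N₁ N₂ : APA A AP)
    (hdet₁ : N₁.IsDeterministic) (hdet₂ : N₂.IsDeterministic)
    (hsv₁ : N₁.IsSVNF) (hsv₂ : N₂.IsSVNF)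
    (hcons₁ : N₁.IsLocallyConsistent)
    (hnot : ¬ N₁.Refines N₂) :
    thoroughDist lam (N₁.overDiff N₂).impl (N₁.impl \ N₂.impl) = 0 := by
  refine APA.thoroughDist_eq_zero_of_close hlam₁ fun P hP k => ?_
  obtain ⟨s₁, hs₁⟩ := hdet₁.2.2
  obtain ⟨s₂, hs₂⟩ := hdet₂.2.2
  have hi₁ : ∀ Q : PA A AP, Q ∈ N₁.impl ↔ APA.Implements Q N₁ Q.init s₁ := fun Q => by
    simp [APA.mem_impl_iff, hs₁]
  have hi₂ : ∀ Q : PA A AP, Q ∈ N₂.impl ↔ APA.Implements Q N₂ Q.init s₂ := fun Q => by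
    simp [APA.mem_impl_iff, hs₂]
  by_cases hV : ∃ s₁ ∈ N₁.init, ∃ s₂ ∈ N₂.init, N₁.V s₁ ≠ N₂.V s₂
  · rw [APA.overDiff, if_pos hV] at hP
    refine ⟨P, ⟨hP, fun hP₂ => ?_⟩, .refl P k P.init⟩
    obtain ⟨t₁, ht₁, t₂, ht₂, hne⟩ := hV
    rw [hs₁] at ht₁
    rw [hs₂] at ht₂
    obtain rfl := ht₁
    obtain rfl := ht₂
    rw [hi₁] at hP
    rw [hi₂] at hP₂
    exact hne ((hsv₁.V_eq hP.step.1).trans (hsv₂.V_eq hP₂.step.1).symm)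
  · have hP' : P ∈ (APA.diffAPA N₁ N₂).impl := by
      rw [APA.overDiff, if_neg hV] at hP
      exact hP
    obtain ⟨_, ⟨t₁, ht₁, t₂, ht₂, f, hf, rfl⟩, himp⟩ := APA.mem_impl_iff.mp hP'
    rw [hs₁] at ht₁
    rw [hs₂] at ht₂
    obtain rfl := ht₁
    obtain rfl := ht₂
    obtain ⟨Q, hc, hQ₁, hQ₂⟩ := APA.exists_close_implements_not_implements hdet₁ hdet₂ hsv₁ hsv₂
      hcons₁ P k hf himp
    exact ⟨Q, ⟨(hi₁ Q).mpr hQ₁, fun h => hQ₂ ((hi₂ Q).mp h)⟩, hc⟩
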